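/- **Setting.** Fix a countably infinite set of variables, a first-order signature, and two disjoint families of constraint symbols, *built-in* and *user-defined*; the built-in ones include falsity $\bot$ and the binary symbol $\doteq$. A *built-in constraint* $\mathbb B$ (*user-defined constraint* $\mathbb U$) is a possibly empty conjunction of atomic built-in (user-defined) constraints; a *goal* $\mathbb G$ is a possibly empty conjunction of atomic constraints of either kind; the empty conjunction is $\top$. Write $\mathbb G\equiv_G\mathbb G'$ for equality up to associativity and commutativity of $\wedge$ and neutrality of $\top$. A *constraint theory* $CT$ is a set of closed formulas $\forall(\exists\bar x.\mathbb B\to\exists\bar x'.\mathbb B')$ with built-in $\mathbb B,\mathbb B'$, and $CT\models\varphi$ means that $\varphi$ is derivable from $CT$ in intuitionistic first-order logic with equality $\doteq$ (free variables being read universally). Further laws of syntactic equality may be among the axioms of $CT$. A *CHR state* is a pair $\langle\mathbb G;\mathbb V\rangle$ of a goal and a finite set of (global) variables. Its *local* variables are those in $\mathrm{vars}(\mathbb G)\setminus\mathbb V$; the *strictly local* variables of $\langle\mathbb U\wedge\mathbb B;\mathbb V\rangle$ are its local variables that do not occur in $\mathbb U$. *State equivalence* $\equiv$ is the smallest equivalence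 relation on CHR states such that 1. $\langle\mathbb G;\mathbb V\rangle\equiv\langle\mathbb G';\mathbb V\rangle$ if $\mathbb G\equiv_G\mathbb G'$; 2. $\langle\mathbb U\wedge x\doteq t\wedge\mathbb B;\mathbb V\rangle\equiv\langle\mathbb U[x/t]\wedge x\doteq t\wedge\mathbb B;\mathbb V\rangle$, where $[x/t]$ replaces the variable $x$ by the term $t$; 3. $\langle\mathbb U\wedge\mathbb B;\mathbb V\rangle\equiv\langle\mathbb U\wedge\mathbb B';\mathbb V\rangle$ if $CT\models\exists\bar s.\mathbb B\leftrightarrow\exists\bar s'.\mathbb B'$, where $\bar s,\bar s'$ are the strictly local variables of the two states; 4. $\langle\mathbb G;\{x\}\cup\mathbb V\rangle\equiv\langle\mathbb G;\mathbb V\rangle$ if $x\notin\mathrm{vars}(\mathbb G)$; 5. $\langle\mathbb G\wedge\bot;\mathbb V\rangle\equiv\langle\mathbb G'\wedge\bot;\mathbb V'\rangle$ for all $\mathbb G,\mathbb G',\mathbb V,\mathbb V'$. The *linear-logic reading* is $c_u(\bar t)^L=c_u(\bar t)$ for user-defined atoms, $c_b(\bar t)^L={!}c_b(\bar t)$ for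 built-in atoms other than $\bot$, $\bot^L=\mathbf 0$, $\top^L=\mathbf 1$, $(\mathbb G\wedge\mathbb G')^L=\mathbb G^L\otimes\mathbb G'^L$, and $\langle\mathbb G;\mathbb V\rangle^L=\exists\bar l.\,\mathbb G^L$, where $\bar l$ are the local variables of the state. Let $\Sigma_{CT}$ be the set of all sequents $\exists\bar x.\mathbb B^L\vdash\exists\bar x'.\mathbb B'^L$ such that $CT\models\exists\bar x.\mathbb B\to\exists\bar x'.\mathbb B'$, with $\mathbb B,\mathbb B'$ built-in constraints and $\bar x,\bar x'$ finite sets of variables. Let $\Sigma_{\doteq}$ be the set of all sequents $$c_u(\dots,t_j,\dots)\otimes{!}(t_j\doteq u)\ \vdash\ c_u(\dots,u,\dots)\otimes{!}(t_j\doteq u),$$ where $c_u$ is a user-defined symbol, $t_j$ is its $j$-th argument, which is replaced by $u$ on the right, and $u$ is a term. For a set $\Sigma$ of sequents, $\alpha\dashv\vdash_\Sigma\beta$ means that both $\alpha\vdash\beta$ and $\beta\vdash\alpha$ are provable in the sequent calculus (with cut) of first-order intuitionistic linear logic with the sequents in $\Sigma$ as additional (proper) axioms. **Theorem.** Let $CT$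 be a constraint theory and $\Sigma=\Sigma_{CT}\cup\Sigma_{\doteq}$. For all CHR states $S,T$, $$S\equiv T\quad\Longleftrightarrow\quad S^L\dashv\vdash_\Sigma T^L .$$ -/

import Mathlib

/-!
Constraint Handling Rules (CHR) states, their equivalence, and their reading in intuitionistic
linear logic.

Conventions.
* The variables are the natural numbers. Terms over the function symbols of a first-order language
  `L` are Mathlib's `L.Term ℕ`. The relation symbols of `L` are the built-in constraint symbols
  other than falsity and equality; `P n` is the type of user-defined `n`-ary constraint symbols.
* Formulas are indexed by the type `α` of their free variables. A quantifier binds the variable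
  `none : Option α`, so that formulas are identified up to renaming of bound variables and
  substitution never captures.
-/

universe u v w

namespace CHR

open FirstOrder FirstOrder.Language

/-! ### Substitution -/

section Substitution

variable {L : FirstOrder.Language.{u, v}}

/-- The substitution `σ`, extended under a quantifier (the bound variable `none` is fixed). -/
def liftSubst {α β : Type} (σ : α → L.Term β) : Option α → L.Term (Option β)
  | none => Term.var none
  | some a => (σ a).relabel some

/-- Put the term `t` for the variable `none`. -/
def instSubst {α : Type} (t : L.Term α) : Option α → L.Term α
  | none => t
  | some a => Term.var a

/-- Turn the named variable `x` into the variable `none`, which is about to be bound. -/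
def bindSubst (x : ℕ) (y : ℕ) : L.Term (Option ℕ) :=
  if y = x then Term.var none else Term.var (some y)

/-- The substitution `[x / t]`, replacing `x` by `t`. -/
def singleSubst (x : ℕ) (t : L.Term ℕ) (y : ℕ) : L.Term ℕ :=
  if y = x then t else Term.var y

end Substitution

/-! ### Constraints, goals and states -/

/-- Atomic built-in constraints: falsity `⊥`, syntactic equality `s ≐ t`, and `c_b(t₁, …, tₙ)`. -/
inductive BAtom (L : FirstOrder.Language.{u, v}) : Type (max u v)
  | bot : BAtom L
  | eq (s t : L.Term ℕ) : BAtom L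
  | rel {n : ℕ} (c : L.Relations n) (ts : Fin n → L.Term ℕ) : BAtom L

/-- Built-in constraints `𝔹 ::= ⊤ | c_b(t) | 𝔹 ∧ 𝔹'`. -/
inductive Builtin (L : FirstOrder.Language.{u, v}) : Type (max u v)
  | top : Builtin L
  | atom (b : BAtom L) : Builtin L
  | and (B B' : Builtin L) : Builtin L

/-- User-defined constraints `𝕌 ::= ⊤ | c_u(t) | 𝕌 ∧ 𝕌'`. -/
inductive UserC (L : FirstOrder.Language.{u, v}) (P : ℕ → Type w) : Type (max u w)
  | top : UserC L P
  | atom {n : ℕ} (c : P n) (ts : Fin n → L.Term ℕ) : UserC L P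
  | and (U U' : UserC L P) : UserC L P

/-- Goals `𝔾 ::= ⊤ | c_u(t) | c_b(t) | 𝔾 ∧ 𝔾'`. -/
inductive Goal (L : FirstOrder.Language.{u, v}) (P : ℕ → Type w) : Type (max u v w)
  | top : Goal L P
  | user {n : ℕ} (c : P n) (ts : Fin n → L.Term ℕ) : Goal L P
  | builtin (b : BAtom L) : Goal L P
  | and (G G' : Goal L P) : Goal L P

section Constraints

variable {L : FirstOrder.Language.{u, v}} {P : ℕ → Type w}

/-- The variables of an atomic built-in constraint. -/
def BAtom.vars : BAtom L → Finset ℕ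
  | .bot => ∅
  | .eq s t => s.varFinset ∪ t.varFinset
  | .rel _ ts => Finset.univ.biUnion fun i => (ts i).varFinset

/-- The variables of a built-in constraint. -/
def Builtin.vars : Builtin L → Finset ℕ
  | .top => ∅
  | .atom b => b.vars
  | .and B B' => B.vars ∪ B'.vars

/-- The variables of a user-defined constraint. -/
def UserC.vars : UserC L P → Finset ℕ
  | .top => ∅
  | .atom _ ts => Finset.univ.biUnion fun i => (ts i).varFinset
  | .and U U' => U.vars ∪ U'.vars

/-- The variables of a goal. -/
def Goal.vars : Goal L P → Finset ℕ
  | .top => ∅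
  | .user _ ts => Finset.univ.biUnion fun i => (ts i).varFinset
  | .builtin b => b.vars
  | .and G G' => G.vars ∪ G'.vars

/-- The substitution `𝕌[x / t]`. -/
def UserC.subst (x : ℕ) (t : L.Term ℕ) : UserC L P → UserC L P
  | .top => .top
  | .atom c ts => .atom c fun i => (ts i).subst (singleSubst x t)
  | .and U U' => .and (U.subst x t) (U'.subst x t)

/-- A built-in constraint as a goal. -/
def Builtin.toGoal (P : ℕ → Type w) : Builtin L → Goal L P
  | .top => .top
  | .atom b => .builtin b
  | .and B B' => .and (B.toGoal P) (B'.toGoal P)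

/-- A user-defined constraint as a goal. -/
def UserC.toGoal : UserC L P → Goal L P
  | .top => .top
  | .atom c ts => .user c ts
  | .and U U' => .and U.toGoal U'.toGoal

/-- Goal equivalence `𝔾 ≡_G 𝔾'`: associativity and commutativity of `∧`, neutrality of `⊤`. -/
inductive GoalEquiv : Goal L P → Goal L P → Prop
  | refl (G) : GoalEquiv G G
  | symm {G G'} : GoalEquiv G G' → GoalEquiv G' G
  | trans {G G' G''} : GoalEquiv G G' → GoalEquiv G' G'' → GoalEquiv G G''
  | congr {G₁ G₁' G₂ G₂'} : GoalEquiv G₁ G₁' → GoalEquiv G₂ G₂' →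
      GoalEquiv (.and G₁ G₂) (.and G₁' G₂')
  | assoc (G₁ G₂ G₃) : GoalEquiv (.and (.and G₁ G₂) G₃) (.and G₁ (.and G₂ G₃))
  | comm (G₁ G₂) : GoalEquiv (.and G₁ G₂) (.and G₂ G₁)
  | top_and (G) : GoalEquiv (.and .top G) G

end Constraints

/-- A CHR state `⟨𝔾; 𝕍⟩`: a goal and a (finite) set of global variables. -/
structure State (L : FirstOrder.Language.{u, v}) (P : ℕ → Type w) : Type (max u v w) where
  goal : Goal L P
  globals : Finset ℕ

/-- The state `⟨𝕌 ∧ 𝔹; 𝕍⟩`, also written `⟨𝕌; 𝔹; 𝕍⟩`. -/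
def State.normal {L : FirstOrder.Language.{u, v}} {P : ℕ → Type w}
    (U : UserC L P) (B : Builtin L) (V : Finset ℕ) : State L P :=
  ⟨.and U.toGoal (B.toGoal P), V⟩

/-- The local variables of a state. -/
def State.localVars {L : FirstOrder.Language.{u, v}} {P : ℕ → Type w} (S : State L P) : Finset ℕ :=
  S.goal.vars \ S.globals

/-- The strictly local variables of the state `⟨𝕌 ∧ 𝔹; 𝕍⟩`. -/
def strictlyLocal {L : FirstOrder.Language.{u, v}} {P : ℕ → Type w}
    (U : UserC L P) (B : Builtin L) (V : Finset ℕ) : Finset ℕ :=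
  (State.normal U B V).localVars \ U.vars

/-! ### Intuitionistic first-order logic with equality -/

/-- First-order formulas over the built-in constraint symbols, with free variables in `α`. -/
inductive IL (L : FirstOrder.Language.{u, v}) : Type → Type (max u v 1)
  | bot {α : Type} : IL L α
  | top {α : Type} : IL L α
  | eq {α : Type} (s t : L.Term α) : IL L α
  | rel {α : Type} {n : ℕ} (c : L.Relations n) (ts : Fin n → L.Term α) : IL L α
  | and {α : Type} (φ ψ : IL L α) : IL L α
  | or {α : Type} (φ ψ : IL L α) : IL L α
  | imp {α : Type} (φ ψ : IL L α) : IL L α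
  | all {α : Type} (φ : IL L (Option α)) : IL L α
  | ex {α : Type} (φ : IL L (Option α)) : IL L α

namespace IL

variable {L : FirstOrder.Language.{u, v}}

/-- Simultaneous substitution of terms for the free variables. -/
def subst : {α : Type} → IL L α → {β : Type} → (α → L.Term β) → IL L β
  | _, bot, _, _ => bot
  | _, top, _, _ => top
  | _, eq s t, _, σ => eq (s.subst σ) (t.subst σ)
  | _, rel c ts, _, σ => rel c fun i => (ts i).subst σ
  | _, and φ ψ, _, σ => and (φ.subst σ) (ψ.subst σ)
  | _, or φ ψ, _, σ => or (φ.subst σ) (ψ.subst σ)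
  | _, imp φ ψ, _, σ => imp (φ.subst σ) (ψ.subst σ)
  | _, all φ, _, σ => all (φ.subst (liftSubst σ))
  | _, ex φ, _, σ => ex (φ.subst (liftSubst σ))

/-- The free variables. -/
def fv : {α : Type} → [DecidableEq α] → IL L α → Finset α
  | _, _, bot => ∅
  | _, _, top => ∅
  | _, _, eq s t => s.varFinset ∪ t.varFinset
  | _, _, rel _ ts => Finset.univ.biUnion fun i => (ts i).varFinset
  | _, _, and φ ψ => φ.fv ∪ ψ.fv
  | _, _, or φ ψ => φ.fv ∪ ψ.fv
  | _, _, imp φ ψ => φ.fv ∪ ψ.fv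
  | _, _, all φ => Finset.eraseNone φ.fv
  | _, _, ex φ => Finset.eraseNone φ.fv

/-- Instantiate the outermost bound variable by `t`. -/
def inst {α : Type} (φ : IL L (Option α)) (t : L.Term α) : IL L α := φ.subst (instSubst t)

/-- `∀ x. φ` for a named variable `x`. -/
def allVar (x : ℕ) (φ : IL L ℕ) : IL L ℕ := all (φ.subst (bindSubst x))

/-- `∃ x. φ` for a named variable `x`. -/
def exVar (x : ℕ) (φ : IL L ℕ) : IL L ℕ := ex (φ.subst (bindSubst x))

/-- `∀ x̄. φ` for a finite set of variables `x̄` (listed in increasing order). -/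
def alls (xs : Finset ℕ) (φ : IL L ℕ) : IL L ℕ := xs.sort.foldr allVar φ

/-- `∃ x̄. φ` for a finite set of variables `x̄` (listed in increasing order). -/
def exs (xs : Finset ℕ) (φ : IL L ℕ) : IL L ℕ := xs.sort.foldr exVar φ

/-- The universal closure `∀(φ)`. -/
def closure (φ : IL L ℕ) : IL L ℕ := alls φ.fv φ

/-- `φ ↔ ψ`. -/
def iff {α : Type} (φ ψ : IL L α) : IL L α := and (imp φ ψ) (imp ψ φ)

/-- Natural deduction for intuitionistic first-order logic with equality: `Γ ⊢ φ`. -/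
inductive Provable : Set (IL L ℕ) → IL L ℕ → Prop
  | hyp {Γ φ} : φ ∈ Γ → Provable Γ φ
  | botE {Γ} (φ) : Provable Γ bot → Provable Γ φ
  | topI {Γ} : Provable Γ top
  | andI {Γ φ ψ} : Provable Γ φ → Provable Γ ψ → Provable Γ (and φ ψ)
  | andE₁ {Γ φ ψ} : Provable Γ (and φ ψ) → Provable Γ φ
  | andE₂ {Γ φ ψ} : Provable Γ (and φ ψ) → Provable Γ ψ
  | orI₁ {Γ φ ψ} : Provable Γ φ → Provable Γ (or φ ψ)
  | orI₂ {Γ φ ψ} : Provable Γ ψ → Provable Γ (or φ ψ)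
  | orE {Γ φ ψ χ} : Provable Γ (or φ ψ) → Provable (insert φ Γ) χ → Provable (insert ψ Γ) χ →
      Provable Γ χ
  | impI {Γ φ ψ} : Provable (insert φ Γ) ψ → Provable Γ (imp φ ψ)
  | impE {Γ φ ψ} : Provable Γ (imp φ ψ) → Provable Γ φ → Provable Γ ψ
  | allI {Γ φ} (a : ℕ) : (∀ γ ∈ Γ, a ∉ γ.fv) → a ∉ (all φ).fv →
      Provable Γ (φ.inst (Term.var a)) → Provable Γ (all φ)
  | allE {Γ φ} (t : L.Term ℕ) : Provable Γ (all φ) → Provable Γ (φ.inst t)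
  | exI {Γ φ} (t : L.Term ℕ) : Provable Γ (φ.inst t) → Provable Γ (ex φ)
  | exE {Γ φ ψ} (a : ℕ) : (∀ γ ∈ Γ, a ∉ γ.fv) → a ∉ (ex φ).fv → a ∉ ψ.fv →
      Provable Γ (ex φ) → Provable (insert (φ.inst (Term.var a)) Γ) ψ → Provable Γ ψ
  | eqRefl {Γ} (t : L.Term ℕ) : Provable Γ (eq t t)
  | eqSubst {Γ} {s t : L.Term ℕ} (φ : IL L (Option ℕ)) : Provable Γ (eq s t) →
      Provable Γ (φ.inst s) → Provable Γ (φ.inst t)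

end IL

/-! ### Constraint theories -/

section Theories

variable {L : FirstOrder.Language.{u, v}}

/-- An atomic built-in constraint as a formula. -/
def BAtom.toIL : BAtom L → IL L ℕ
  | .bot => .bot
  | .eq s t => .eq s t
  | .rel c ts => .rel c ts

/-- A built-in constraint as a formula. -/
def Builtin.toIL : Builtin L → IL L ℕ
  | .top => .top
  | .atom b => b.toIL
  | .and B B' => .and B.toIL B'.toIL

/-- The data of a `CT`-axiom `∀(∃ x̄. 𝔹 → ∃ x̄'. 𝔹')`. -/
structure CTAxiom (L : FirstOrder.Language.{u, v}) : Type (max u v) where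
  lhsVars : Finset ℕ
  lhs : Builtin L
  rhsVars : Finset ℕ
  rhs : Builtin L

/-- The closed formula `∀(∃ x̄. 𝔹 → ∃ x̄'. 𝔹')`. -/
def CTAxiom.formula (A : CTAxiom L) : IL L ℕ :=
  (IL.imp (IL.exs A.lhsVars A.lhs.toIL) (IL.exs A.rhsVars A.rhs.toIL)).closure

/-- A constraint theory, given by its set of `CT`-axioms. The usual laws of equality for `≐` belong
to the logic; further laws of syntactic equality (injectivity and disjointness of function symbols,
acyclicity) have the form of `CT`-axioms and may be among the axioms. -/
abbrev ConstraintTheory (L : FirstOrder.Language.{u, v}) : Type (max u v) := Set (CTAxiom L)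

/-- `CT ⊨ φ`: the formula `φ` is an intuitionistic consequence of the axioms of `CT`. -/
def ConstraintTheory.Entails (CT : ConstraintTheory L) (φ : IL L ℕ) : Prop :=
  IL.Provable (CTAxiom.formula '' CT) φ

end Theories

/-! ### Equivalence of CHR states -/

/-- State equivalence `S ≡ T` for a constraint theory `CT`: the smallest equivalence relation that
satisfies the five conditions below. -/
inductive StateEquiv {L : FirstOrder.Language.{u, v}} {P : ℕ → Type w} (CT : ConstraintTheory L) :
    State L P → State L P → Prop
  | refl (S) : StateEquiv CT S S
  | symm {S T} : StateEquiv CT S T → StateEquiv CT T S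
  | trans {S T R} : StateEquiv CT S T → StateEquiv CT T R → StateEquiv CT S R
  /-- Goal transformation. -/
  | goal {G G' : Goal L P} (V : Finset ℕ) : GoalEquiv G G' → StateEquiv CT ⟨G, V⟩ ⟨G', V⟩
  /-- Equality as substitution. -/
  | subst (U : UserC L P) (x : ℕ) (t : L.Term ℕ) (B : Builtin L) (V : Finset ℕ) :
      StateEquiv CT (.normal U (.and (.atom (.eq (Term.var x) t)) B) V)
        (.normal (U.subst x t) (.and (.atom (.eq (Term.var x) t)) B) V)
  /-- Application of `CT`. -/
  | theory (U : UserC L P) (B B' : Builtin L) (V : Finset ℕ) :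
      CT.Entails (IL.iff (IL.exs (strictlyLocal U B V) B.toIL)
        (IL.exs (strictlyLocal U B' V) B'.toIL)) →
      StateEquiv CT (.normal U B V) (.normal U B' V)
  /-- Neutrality of redundant global variables. -/
  | global (G : Goal L P) (x : ℕ) (V : Finset ℕ) : x ∉ G.vars →
      StateEquiv CT ⟨G, {x} ∪ V⟩ ⟨G, V⟩
  /-- Equivalence of failed states. -/
  | failed (G G' : Goal L P) (V V' : Finset ℕ) :
      StateEquiv CT ⟨.and G (.builtin .bot), V⟩ ⟨.and G' (.builtin .bot), V'⟩

/-! ### Intuitionistic linear logic -/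

/-- Formulas of first-order intuitionistic linear logic over the built-in and the user-defined
constraint symbols, with free variables in `α`. -/
inductive ILL (L : FirstOrder.Language.{u, v}) (P : ℕ → Type w) : Type → Type (max u v w 1)
  | eq {α : Type} (s t : L.Term α) : ILL L P α
  | rel {α : Type} {n : ℕ} (c : L.Relations n) (ts : Fin n → L.Term α) : ILL L P α
  | user {α : Type} {n : ℕ} (c : P n) (ts : Fin n → L.Term α) : ILL L P α
  | one {α : Type} : ILL L P α
  | zero {α : Type} : ILL L P α
  | top {α : Type} : ILL L P α
  | tensor {α : Type} (φ ψ : ILL L P α) : ILL L P α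
  | lolli {α : Type} (φ ψ : ILL L P α) : ILL L P α
  | with {α : Type} (φ ψ : ILL L P α) : ILL L P α
  | plus {α : Type} (φ ψ : ILL L P α) : ILL L P α
  | bang {α : Type} (φ : ILL L P α) : ILL L P α
  | all {α : Type} (φ : ILL L P (Option α)) : ILL L P α
  | ex {α : Type} (φ : ILL L P (Option α)) : ILL L P α

namespace ILL

variable {L : FirstOrder.Language.{u, v}} {P : ℕ → Type w}

/-- Simultaneous substitution of terms for the free variables. -/
def subst : {α : Type} → ILL L P α → {β : Type} → (α → L.Term β) → ILL L P β
  | _, eq s t, _, σ => eq (s.subst σ) (t.subst σ)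
  | _, rel c ts, _, σ => rel c fun i => (ts i).subst σ
  | _, user c ts, _, σ => user c fun i => (ts i).subst σ
  | _, one, _, _ => one
  | _, zero, _, _ => zero
  | _, top, _, _ => top
  | _, tensor φ ψ, _, σ => tensor (φ.subst σ) (ψ.subst σ)
  | _, lolli φ ψ, _, σ => lolli (φ.subst σ) (ψ.subst σ)
  | _, .with φ ψ, _, σ => .with (φ.subst σ) (ψ.subst σ)
  | _, plus φ ψ, _, σ => plus (φ.subst σ) (ψ.subst σ)
  | _, bang φ, _, σ => bang (φ.subst σ)
  | _, all φ, _, σ => all (φ.subst (liftSubst σ))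
  | _, ex φ, _, σ => ex (φ.subst (liftSubst σ))

/-- The free variables. -/
def fv : {α : Type} → [DecidableEq α] → ILL L P α → Finset α
  | _, _, eq s t => s.varFinset ∪ t.varFinset
  | _, _, rel _ ts => Finset.univ.biUnion fun i => (ts i).varFinset
  | _, _, user _ ts => Finset.univ.biUnion fun i => (ts i).varFinset
  | _, _, one => ∅
  | _, _, zero => ∅
  | _, _, top => ∅
  | _, _, tensor φ ψ => φ.fv ∪ ψ.fv
  | _, _, lolli φ ψ => φ.fv ∪ ψ.fv
  | _, _, .with φ ψ => φ.fv ∪ ψ.fv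
  | _, _, plus φ ψ => φ.fv ∪ ψ.fv
  | _, _, bang φ => φ.fv
  | _, _, all φ => Finset.eraseNone φ.fv
  | _, _, ex φ => Finset.eraseNone φ.fv

/-- Instantiate the outermost bound variable by `t`. -/
def inst {α : Type} (φ : ILL L P (Option α)) (t : L.Term α) : ILL L P α := φ.subst (instSubst t)

/-- `∃ x. φ` for a named variable `x`. -/
def exVar (x : ℕ) (φ : ILL L P ℕ) : ILL L P ℕ := ex (φ.subst (bindSubst x))

/-- `∃ x̄. φ` for a finite set of variables `x̄` (listed in increasing order). -/
def exs (xs : Finset ℕ) (φ : ILL L P ℕ) : ILL L P ℕ := xs.sort.foldr exVar φ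

end ILL

/-- A sequent `Γ ⊢ φ`: a multiset of formulas and a formula. -/
abbrev Sequent (L : FirstOrder.Language.{u, v}) (P : ℕ → Type w) : Type (max u v w 1) :=
  Multiset (ILL L P ℕ) × ILL L P ℕ

namespace ILL

variable {L : FirstOrder.Language.{u, v}} {P : ℕ → Type w}

/-- The sequent calculus of first-order intuitionistic linear logic, with cut and with the proper
axioms `Ax`: `Γ ⊢_Ax φ`. -/
inductive Provable (Ax : Set (Sequent L P)) : Multiset (ILL L P ℕ) → ILL L P ℕ → Prop
  | proper {Γ φ} : (Γ, φ) ∈ Ax → Provable Ax Γ φ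
  | identity (φ) : Provable Ax {φ} φ
  | cut {Γ Δ φ ψ} : Provable Ax Γ φ → Provable Ax (φ ::ₘ Δ) ψ → Provable Ax (Γ + Δ) ψ
  | tensorL {Γ φ ψ χ} : Provable Ax (φ ::ₘ ψ ::ₘ Γ) χ → Provable Ax (tensor φ ψ ::ₘ Γ) χ
  | tensorR {Γ Δ φ ψ} : Provable Ax Γ φ → Provable Ax Δ ψ → Provable Ax (Γ + Δ) (tensor φ ψ)
  | oneL {Γ φ} : Provable Ax Γ φ → Provable Ax (one ::ₘ Γ) φ
  | oneR : Provable Ax 0 one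
  | lolliL {Γ Δ φ ψ χ} : Provable Ax Γ φ → Provable Ax (ψ ::ₘ Δ) χ →
      Provable Ax (lolli φ ψ ::ₘ (Γ + Δ)) χ
  | lolliR {Γ φ ψ} : Provable Ax (φ ::ₘ Γ) ψ → Provable Ax Γ (lolli φ ψ)
  | bangR {Γ : Multiset (ILL L P ℕ)} {φ} : Provable Ax (Γ.map bang) φ →
      Provable Ax (Γ.map bang) (bang φ)
  | dereliction {Γ φ ψ} : Provable Ax (φ ::ₘ Γ) ψ → Provable Ax (bang φ ::ₘ Γ) ψ
  | contraction {Γ φ ψ} : Provable Ax (bang φ ::ₘ bang φ ::ₘ Γ) ψ → Provable Ax (bang φ ::ₘ Γ) ψ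
  | weakening {Γ φ ψ} : Provable Ax Γ ψ → Provable Ax (bang φ ::ₘ Γ) ψ
  | withL₁ {Γ φ ψ χ} : Provable Ax (φ ::ₘ Γ) χ → Provable Ax (.with φ ψ ::ₘ Γ) χ
  | withL₂ {Γ φ ψ χ} : Provable Ax (ψ ::ₘ Γ) χ → Provable Ax (.with φ ψ ::ₘ Γ) χ
  | withR {Γ φ ψ} : Provable Ax Γ φ → Provable Ax Γ ψ → Provable Ax Γ (.with φ ψ)
  | topR (Γ) : Provable Ax Γ top
  | plusL {Γ φ ψ χ} : Provable Ax (φ ::ₘ Γ) χ → Provable Ax (ψ ::ₘ Γ) χ →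
      Provable Ax (plus φ ψ ::ₘ Γ) χ
  | plusR₁ {Γ φ ψ} : Provable Ax Γ φ → Provable Ax Γ (plus φ ψ)
  | plusR₂ {Γ φ ψ} : Provable Ax Γ ψ → Provable Ax Γ (plus φ ψ)
  | zeroL (φ) : Provable Ax {zero} φ
  | allL {Γ φ ψ} (t : L.Term ℕ) : Provable Ax (φ.inst t ::ₘ Γ) ψ → Provable Ax (all φ ::ₘ Γ) ψ
  | allR {Γ φ} (a : ℕ) : (∀ γ ∈ Γ, a ∉ γ.fv) → a ∉ (all φ).fv →
      Provable Ax Γ (φ.inst (Term.var a)) → Provable Ax Γ (all φ)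
  | exL {Γ φ ψ} (a : ℕ) : (∀ γ ∈ Γ, a ∉ γ.fv) → a ∉ (ex φ).fv → a ∉ ψ.fv →
      Provable Ax (φ.inst (Term.var a) ::ₘ Γ) ψ → Provable Ax (ex φ ::ₘ Γ) ψ
  | exR {Γ φ} (t : L.Term ℕ) : Provable Ax Γ (φ.inst t) → Provable Ax Γ (ex φ)

/-- Logical equivalence modulo the proper axioms `Ax`: `φ ⊣⊢_Ax ψ`. -/
def EquivMod (Ax : Set (Sequent L P)) (φ ψ : ILL L P ℕ) : Prop :=
  Provable Ax {φ} ψ ∧ Provable Ax {ψ} φ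

end ILL

/-! ### The linear-logic reading of CHR -/

section Reading

variable {L : FirstOrder.Language.{u, v}}

/-- `⊥ᴸ = 0` and `c_b(t)ᴸ = !c_b(t)` for every other atomic built-in constraint. -/
def BAtom.toILL (P : ℕ → Type w) : BAtom L → ILL L P ℕ
  | .bot => .zero
  | .eq s t => .bang (.eq s t)
  | .rel c ts => .bang (.rel c ts)

/-- The linear-logic reading of a goal. -/
def Goal.toILL {P : ℕ → Type w} : Goal L P → ILL L P ℕ
  | .top => .one
  | .user c ts => .user c ts
  | .builtin b => b.toILL P
  | .and G G' => .tensor G.toILL G'.toILL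

/-- The linear-logic reading `𝔹ᴸ` of a built-in constraint. -/
def Builtin.toILL (P : ℕ → Type w) (B : Builtin L) : ILL L P ℕ := (B.toGoal P).toILL

/-- The linear-logic reading of a state, `⟨𝔾; 𝕍⟩ᴸ = ∃_{-𝕍}. 𝔾ᴸ`: all variables that are not global
are quantified. -/
def State.toILL {P : ℕ → Type w} (S : State L P) : ILL L P ℕ := .exs S.localVars S.goal.toILL

/-- The proper axioms `∃ x̄. 𝔹ᴸ ⊢ ∃ x̄'. 𝔹'ᴸ`, whenever `CT ⊨ ∃ x̄. 𝔹 → ∃ x̄'. 𝔹'`. -/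
def sigmaCT (P : ℕ → Type w) (CT : ConstraintTheory L) : Set (Sequent L P) :=
  {s | ∃ (xs : Finset ℕ) (B : Builtin L) (xs' : Finset ℕ) (B' : Builtin L),
    CT.Entails (IL.imp (IL.exs xs B.toIL) (IL.exs xs' B'.toIL)) ∧
    s = ({ILL.exs xs (B.toILL P)}, ILL.exs xs' (B'.toILL P))}

/-- The proper axioms `c_u(…, t_j, …) ⊗ !(t_j ≐ r) ⊢ c_u(…, r, …) ⊗ !(t_j ≐ r)`. -/
def sigmaEq (L : FirstOrder.Language.{u, v}) (P : ℕ → Type w) : Set (Sequent L P) :=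
  {s | ∃ (n : ℕ) (c : P n) (ts : Fin n → L.Term ℕ) (j : Fin n) (r : L.Term ℕ),
    s = ({.tensor (.user c ts) (.bang (.eq (ts j) r))},
      .tensor (.user c (Function.update ts j r)) (.bang (.eq (ts j) r)))}

end Reading

end CHR

/-!
**From equivalence to derivations.** Every clause of state equivalence is simulated by a short
derivation (`StateEquiv.equivMod`). The clause for `CT` uses an axiom of `Σ_CT` below the quantifiers
for the local variables of the user-defined constraint, the substitution clause rewrites the atoms
argument by argument with `Σ_≐`, and a failed state contains `0`.

**From derivations to equivalence.** Derivations may contain cuts on arbitrary formulas, so instead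
of analysing them they are interpreted in a phase model. A world is a pair `(M, Γ)` of a multiset `M`
of user-defined atoms and a finite context `Γ` of formulas, and quantifiers range over the terms with
variables. Formulas denote sets of worlds that are closed: stable under strengthening `Γ`, containing
all inconsistent worlds, and local for the covers of `Γ ⊢ ∃ψ` by all `ψ(t), Γ`. The last condition
makes `∃` the supremum over all terms, both for linear and for intuitionistic formulas
(`Stable.exs_elim`), so that no witnesses or canonical models are needed. All proper axioms are valid
and the calculus is sound (`ILL.Provable.interp_subset`).

The world consisting of the atoms and the built-in constraint `𝔹` of `S` lies in the denotation of
`Sᴸ`, hence in that of `Tᴸ` if `Sᴸ ⊢ Tᴸ`. The worlds whose atoms match those of `T`, with equations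
and built-in constraint `𝔹'` of `T` entailed by the context, form a closed set; here a fresh variable
as generic instance of a cover makes a single matching serve for all of its members
(`stable_of_formulas`). Therefore `𝔹` is inconsistent or entails `∃ l'. (𝕌 = 𝕌' ∧ 𝔹')` for some
matching `𝕌 = 𝕌'` of the atoms, `l'` being the local variables of `T`
(`exists_matching_of_provable`).

Given derivations in both directions, the two matchings may differ by a permutation of the atoms.
Permutations have finite order, and going back and forth often enough replaces the second matching by
the inverse of the first (`forces_matching_pow`). Then both states are equivalent to the states with
built-in constraint `𝕌 = 𝕌' ∧ 𝔹 ∧ 𝔹'`, whose user-defined constraints can be exchanged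
(`StateEquiv.of_matching`). The same criterion shows that local variables can be renamed, so the
local variables of the two states may be assumed disjoint.

Throughout, entailments are handled as forcing: `Ent CT Γ (φ.subst τ)` plays the role of `φ` being
true at the stage `Γ` under the assignment `τ` of terms to variables.
-/

namespace CHR

open FirstOrder FirstOrder.Language

/-! ### Substitution -/

section Substitution

variable {L : FirstOrder.Language.{u, v}} {P : ℕ → Type w}

/-- The assignment `σ` together with the value `t` for the bound variable `none`. -/
def extendSubst {α β : Type} (t : L.Term β) (σ : α → L.Term β) : Option α → L.Term β
  | none => t
  | some a => σ a

theorem term_subst_subst {α β γ : Type} (t : L.Term α) (σ : α → L.Term β) (τ : β → L.Term γ) :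
    (t.subst σ).subst τ = t.subst fun a => (σ a).subst τ := by
  induction t with
  | var a => rfl
  | func f ts ih => simp only [Term.subst, ih]

theorem term_subst_var {α : Type} (t : L.Term α) : t.subst Term.var = t := by
  induction t with
  | var a => rfl
  | func f ts ih => simp only [Term.subst, ih]

theorem term_relabel_eq_subst {α β : Type} (t : L.Term α) (f : α → β) :
    t.relabel f = t.subst fun a => Term.var (f a) := by
  induction t with
  | var a => rfl
  | func f ts ih => simp only [Term.subst, Term.relabel, ih]

theorem term_subst_congr {α β : Type} [DecidableEq α] {t : L.Term α} {σ τ : α → L.Term β}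
    (h : ∀ a ∈ t.varFinset, σ a = τ a) : t.subst σ = t.subst τ := by
  induction t with
  | var a => exact h a (by simp [Term.varFinset])
  | func f ts ih =>
    simp only [Term.subst, Term.func.injEq, heq_eq_eq, true_and]
    funext i
    exact ih i fun a ha => h a (by
      simp only [Term.varFinset, Finset.mem_biUnion, Finset.mem_univ, true_and]
      exact ⟨i, ha⟩)

theorem mem_varFinset_subst {α β : Type} [DecidableEq α] [DecidableEq β] {t : L.Term α}
    {σ : α → L.Term β} {b : β} :
    b ∈ (t.subst σ).varFinset ↔ ∃ a ∈ t.varFinset, b ∈ (σ a).varFinset := by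
  induction t with
  | var a => simp [Term.subst, Term.varFinset]
  | func f ts ih =>
    simp only [Term.subst, Term.varFinset, Finset.mem_biUnion, Finset.mem_univ, true_and, ih]
    constructor
    · rintro ⟨i, a, ha, hb⟩
      exact ⟨a, ⟨i, ha⟩, hb⟩
    · rintro ⟨a, ⟨i, ha⟩, hb⟩
      exact ⟨i, a, ha, hb⟩

theorem term_subst_relabel {α β γ : Type} (t : L.Term α) (f : α → β) (τ : β → L.Term γ) :
    (t.relabel f).subst τ = t.subst fun a => τ (f a) := by
  rw [term_relabel_eq_subst, term_subst_subst]
  rfl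

theorem liftSubst_liftSubst {α β γ : Type} (σ : α → L.Term β) (τ : β → L.Term γ) :
    (fun a => (liftSubst σ a).subst (liftSubst τ)) = liftSubst fun a => (σ a).subst τ := by
  funext a
  cases a with
  | none => rfl
  | some a =>
    simp only [liftSubst, term_subst_relabel]
    rw [term_relabel_eq_subst, term_subst_subst]
    simp only [term_relabel_eq_subst]

theorem liftSubst_var {α : Type} : liftSubst (L := L) (Term.var : α → L.Term α) = Term.var := by
  funext a
  cases a <;> rfl

theorem liftSubst_extendSubst {α β γ : Type} (σ : α → L.Term β) (t : L.Term γ)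
    (τ : β → L.Term γ) :
    (fun a => (liftSubst σ a).subst (extendSubst t τ)) =
      extendSubst t fun a => (σ a).subst τ := by
  funext a
  cases a with
  | none => rfl
  | some a => simp only [liftSubst, term_subst_relabel, extendSubst]

theorem instSubst_subst {α β : Type} (t : L.Term α) (σ : α → L.Term β) :
    (fun a => (instSubst t a).subst σ) = extendSubst (t.subst σ) σ := by
  funext a
  cases a <;> rfl

theorem instSubst_eq_extendSubst {α : Type} (t : L.Term α) :
    instSubst t = extendSubst t Term.var := by
  funext a
  cases a <;> rfl

theorem bindSubst_extendSubst {β : Type} (x : ℕ) (t : L.Term β) (σ : ℕ → L.Term β) :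
    (fun y => (bindSubst (L := L) x y).subst (extendSubst t σ)) = Function.update σ x t := by
  funext y
  by_cases h : y = x
  · subst h
    simp [bindSubst, Term.subst, extendSubst]
  · simp [bindSubst, Term.subst, extendSubst, h]

theorem liftSubst_congr {α β : Type} [DecidableEq α] {s : Finset (Option α)}
    {σ τ : α → L.Term β} (h : ∀ a ∈ Finset.eraseNone s, σ a = τ a) :
    ∀ a ∈ s, liftSubst σ a = liftSubst τ a := by
  intro a ha
  cases a with
  | none => rfl
  | some a => simp only [liftSubst]; rw [h a (by simpa using ha)]

theorem extendSubst_congr {α β : Type} [DecidableEq α] {s : Finset (Option α)}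
    {σ τ : α → L.Term β} (t : L.Term β) (h : ∀ a ∈ Finset.eraseNone s, σ a = τ a) :
    ∀ a ∈ s, extendSubst t σ a = extendSubst t τ a := by
  intro a ha
  cases a with
  | none => rfl
  | some a => exact h a (by simpa using ha)

theorem mem_eraseNone_of_liftSubst {α β : Type} [DecidableEq α] [DecidableEq β]
    {s : Finset (Option α)} {σ : α → L.Term β} {b : β} {a : Option α} (ha : a ∈ s)
    (hb : some b ∈ (liftSubst σ a).varFinset) :
    ∃ a ∈ Finset.eraseNone s, b ∈ (σ a).varFinset := by
  cases a with
  | none => simp [liftSubst, Term.varFinset] at hb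
  | some a =>
    refine ⟨a, by simpa using ha, ?_⟩
    simp only [liftSubst, term_relabel_eq_subst, mem_varFinset_subst, Term.varFinset,
      Finset.mem_singleton, Option.some.injEq] at hb
    obtain ⟨c, hc, rfl⟩ := hb
    exact hc

theorem mem_eraseNone_of_bindSubst {s : Finset ℕ} {x b y : ℕ} (hy : y ∈ s)
    (hb : some b ∈ (bindSubst (L := L) x y).varFinset) : b ∈ s ∧ b ≠ x := by
  unfold bindSubst at hb
  split_ifs at hb with h
  · simp [Term.varFinset] at hb
  · simp only [Term.varFinset, Finset.mem_singleton, Option.some.injEq] at hb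
    subst hb
    exact ⟨hy, h⟩

namespace IL

theorem subst_subst {α β γ : Type} (φ : IL L α) (σ : α → L.Term β) (τ : β → L.Term γ) :
    (φ.subst σ).subst τ = φ.subst fun a => (σ a).subst τ := by
  induction φ generalizing β γ with
  | bot | top => rfl
  | eq s t => simp only [subst, term_subst_subst]
  | rel c ts => simp only [subst, term_subst_subst]
  | and φ ψ h₁ h₂ | or φ ψ h₁ h₂ | imp φ ψ h₁ h₂ => simp only [subst, h₁, h₂]
  | all φ h | ex φ h => simp only [subst, h, liftSubst_liftSubst]

theorem subst_var {α : Type} (φ : IL L α) : φ.subst Term.var = φ := by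
  induction φ with
  | bot | top => rfl
  | eq s t => simp only [subst, term_subst_var]
  | rel c ts => simp only [subst, term_subst_var]
  | and φ ψ h₁ h₂ | or φ ψ h₁ h₂ | imp φ ψ h₁ h₂ => simp only [subst, h₁, h₂]
  | all φ h | ex φ h => simp only [subst, liftSubst_var, h]

theorem subst_congr {α β : Type} [inst : DecidableEq α] {φ : IL L α} {σ τ : α → L.Term β}
    (h : ∀ a ∈ φ.fv, σ a = τ a) : φ.subst σ = φ.subst τ := by
  revert inst
  induction φ generalizing β with
  | bot | top =>
    intro _ h
    rfl
  | eq s t =>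
    intro _ h
    simp only [fv, Finset.mem_union] at h
    simp only [subst]
    rw [term_subst_congr fun a ha => h a (Or.inl ha), term_subst_congr fun a ha => h a (Or.inr ha)]
  | rel c ts =>
    intro _ h
    simp only [fv, Finset.mem_biUnion, Finset.mem_univ, true_and] at h
    simp only [subst]
    congr 1
    funext i
    exact term_subst_congr fun a ha => h a ⟨i, ha⟩
  | and φ ψ h₁ h₂ | or φ ψ h₁ h₂ | imp φ ψ h₁ h₂ =>
    intro _ h
    simp only [fv, Finset.mem_union] at h
    simp only [subst]
    rw [h₁ fun a ha => h a (Or.inl ha), h₂ fun a ha => h a (Or.inr ha)]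
  | all φ ih | ex φ ih =>
    intro _ h
    simp only [subst]
    rw [ih (liftSubst_congr h)]

theorem exists_mem_fv_of_mem_fv_subst {α β : Type} [instα : DecidableEq α] [DecidableEq β]
    {φ : IL L α} {σ : α → L.Term β} {b : β} (h : b ∈ (φ.subst σ).fv) :
    ∃ a ∈ φ.fv, b ∈ (σ a).varFinset := by
  revert instα
  induction φ generalizing β with
  | bot | top =>
    intro _
    simp [subst, fv] at h
  | eq s t =>
    intro _
    simp only [subst, fv, Finset.mem_union, mem_varFinset_subst] at h ⊢
    grind
  | rel c ts =>
    intro _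
    simp only [subst, fv, Finset.mem_biUnion, Finset.mem_univ, true_and,
      mem_varFinset_subst] at h ⊢
    grind
  | and φ ψ h₁ h₂ | or φ ψ h₁ h₂ | imp φ ψ h₁ h₂ =>
    intro _
    simp only [subst, fv, Finset.mem_union] at h ⊢
    rcases h with h | h
    · obtain ⟨a, ha, hb⟩ := h₁ h
      exact ⟨a, Or.inl ha, hb⟩
    · obtain ⟨a, ha, hb⟩ := h₂ h
      exact ⟨a, Or.inr ha, hb⟩
  | all φ ih | ex φ ih =>
    intro _
    simp only [subst, fv, Finset.mem_eraseNone] at h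
    obtain ⟨a, ha, hb⟩ := ih h
    exact mem_eraseNone_of_liftSubst ha hb

theorem inst_subst {α β : Type} (φ : IL L (Option α)) (t : L.Term α) (σ : α → L.Term β) :
    (φ.inst t).subst σ = φ.subst (extendSubst (t.subst σ) σ) := by
  rw [inst, subst_subst, instSubst_subst]

theorem subst_liftSubst_inst {α β : Type} (φ : IL L (Option α)) (σ : α → L.Term β)
    (t : L.Term β) : (φ.subst (liftSubst σ)).inst t = φ.subst (extendSubst t σ) := by
  rw [inst, subst_subst, instSubst_eq_extendSubst, liftSubst_extendSubst]
  simp only [term_subst_var]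

theorem fv_bindSubst {x b : ℕ} {φ : IL L ℕ} (h : some b ∈ (φ.subst (bindSubst x)).fv) :
    b ∈ φ.fv ∧ b ≠ x := by
  obtain ⟨a, ha, hb⟩ := exists_mem_fv_of_mem_fv_subst h
  exact mem_eraseNone_of_bindSubst ha hb

theorem mem_fv_exs {xs : Finset ℕ} {φ : IL L ℕ} {b : ℕ} (h : b ∈ (exs xs φ).fv) :
    b ∈ φ.fv ∧ b ∉ xs := by
  have key : ∀ l : List ℕ, b ∈ (l.foldr exVar φ).fv → b ∈ φ.fv ∧ b ∉ l := by
    intro l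
    induction l with
    | nil => simp
    | cons x l ih =>
      intro hb
      simp only [List.foldr_cons, exVar, fv, Finset.mem_eraseNone] at hb
      obtain ⟨h₁, h₂⟩ := fv_bindSubst hb
      obtain ⟨h₃, h₄⟩ := ih h₁
      exact ⟨h₃, by simp [h₂, h₄]⟩
  simpa using key _ h

theorem fv_closure (φ : IL L ℕ) : φ.closure.fv = ∅ := by
  have key : ∀ (l : List ℕ) (b : ℕ), b ∈ (l.foldr allVar φ).fv → b ∈ φ.fv ∧ b ∉ l := by
    intro l b
    induction l with
    | nil => simp
    | cons x l ih =>
      intro hb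
      simp only [List.foldr_cons, allVar, fv, Finset.mem_eraseNone] at hb
      obtain ⟨h₁, h₂⟩ := fv_bindSubst hb
      obtain ⟨h₃, h₄⟩ := ih h₁
      exact ⟨h₃, by simp [h₂, h₄]⟩
  refine Finset.eq_empty_of_forall_notMem fun b hb => ?_
  obtain ⟨h₁, h₂⟩ := key _ b hb
  simp [h₁] at h₂

theorem exVar_subst_inst (x : ℕ) (φ : IL L ℕ) (τ : ℕ → L.Term ℕ) (t : L.Term ℕ) :
    ((φ.subst (bindSubst x)).subst (liftSubst τ)).inst t = φ.subst (Function.update τ x t) := by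
  rw [subst_liftSubst_inst, subst_subst, bindSubst_extendSubst]

end IL

namespace ILL

theorem subst_subst {α β γ : Type} (φ : ILL L P α) (σ : α → L.Term β) (τ : β → L.Term γ) :
    (φ.subst σ).subst τ = φ.subst fun a => (σ a).subst τ := by
  induction φ generalizing β γ with
  | one | zero | top => rfl
  | eq s t => simp only [subst, term_subst_subst]
  | rel c ts | user c ts => simp only [subst, term_subst_subst]
  | bang φ h => simp only [subst, h]
  | all φ h | ex φ h => simp only [subst, h, liftSubst_liftSubst]
  | _ φ ψ h₁ h₂ =>
    simp only [subst, h₁, h₂]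

theorem subst_var {α : Type} (φ : ILL L P α) : φ.subst Term.var = φ := by
  induction φ with
  | one | zero | top => rfl
  | eq s t => simp only [subst, term_subst_var]
  | rel c ts | user c ts => simp only [subst, term_subst_var]
  | bang φ h => simp only [subst, h]
  | all φ h | ex φ h => simp only [subst, liftSubst_var, h]
  | _ φ ψ h₁ h₂ =>
    simp only [subst, h₁, h₂]

theorem exists_mem_fv_of_mem_fv_subst {α β : Type} [instα : DecidableEq α] [DecidableEq β]
    {φ : ILL L P α} {σ : α → L.Term β} {b : β} (h : b ∈ (φ.subst σ).fv) :
    ∃ a ∈ φ.fv, b ∈ (σ a).varFinset := by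
  revert instα
  induction φ generalizing β with
  | one | zero | top =>
    intro _
    simp [subst, fv] at h
  | eq s t =>
    intro _
    simp only [subst, fv, Finset.mem_union, mem_varFinset_subst] at h ⊢
    grind
  | rel c ts | user c ts =>
    intro _
    simp only [subst, fv, Finset.mem_biUnion, Finset.mem_univ, true_and,
      mem_varFinset_subst] at h ⊢
    grind
  | bang φ ih =>
    intro _
    exact ih h
  | all φ ih | ex φ ih =>
    intro _
    simp only [subst, fv, Finset.mem_eraseNone] at h
    obtain ⟨a, ha, hb⟩ := ih h
    exact mem_eraseNone_of_liftSubst ha hb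
  | _ φ ψ h₁ h₂ =>
    intro _
    simp only [subst, fv, Finset.mem_union] at h ⊢
    rcases h with h | h
    · obtain ⟨a, ha, hb⟩ := h₁ h
      exact ⟨a, Or.inl ha, hb⟩
    · obtain ⟨a, ha, hb⟩ := h₂ h
      exact ⟨a, Or.inr ha, hb⟩

theorem mem_fv_exVar {x b : ℕ} {φ : ILL L P ℕ} (h : b ∈ (exVar x φ).fv) : b ∈ φ.fv ∧ b ≠ x := by
  simp only [exVar, fv, Finset.mem_eraseNone] at h
  obtain ⟨a, ha, hb⟩ := exists_mem_fv_of_mem_fv_subst h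
  exact mem_eraseNone_of_bindSubst ha hb

theorem mem_fv_exs {xs : Finset ℕ} {φ : ILL L P ℕ} {b : ℕ} (h : b ∈ (exs xs φ).fv) :
    b ∈ φ.fv ∧ b ∉ xs := by
  have key : ∀ l : List ℕ, b ∈ (l.foldr exVar φ).fv → b ∈ φ.fv ∧ b ∉ l := by
    intro l
    induction l with
    | nil => simp
    | cons x l ih =>
      intro hb
      obtain ⟨h₁, h₂⟩ := mem_fv_exVar hb
      obtain ⟨h₃, h₄⟩ := ih h₁
      exact ⟨h₃, by simp [h₂, h₄]⟩
  simpa using key _ h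

theorem bindSubst_inst (x : ℕ) (φ : ILL L P ℕ) :
    (φ.subst (bindSubst x)).inst (Term.var x) = φ := by
  rw [inst, subst_subst, instSubst_eq_extendSubst, bindSubst_extendSubst, Function.update_eq_self,
    subst_var]

end ILL

end Substitution

/-! ### Intuitionistic entailment -/

section Entailment

variable {L : FirstOrder.Language.{u, v}}

theorem IL.infinite_fresh_insert {Γ : Set (IL L ℕ)} (φ : IL L ℕ)
    (h : {b | ∀ γ ∈ Γ, b ∉ γ.fv}.Infinite) : {b | ∀ γ ∈ insert φ Γ, b ∉ γ.fv}.Infinite := by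
  refine (h.sdiff φ.fv.finite_toSet).mono ?_
  rintro b ⟨hb, hb'⟩ γ (rfl | hγ)
  · exact hb'
  · exact hb γ hγ

/-- Provability is closed under substitution and weakening, as long as the new context leaves
infinitely many variables available as eigenvariables. -/
theorem IL.Provable.subst {Γ : Set (IL L ℕ)} {φ : IL L ℕ} (h : Provable Γ φ)
    (σ : ℕ → L.Term ℕ) (Δ : Set (IL L ℕ)) (hΔ : ∀ γ ∈ Γ, γ.subst σ ∈ Δ)
    (hf : {b | ∀ γ ∈ Δ, b ∉ γ.fv}.Infinite) : Provable Δ (φ.subst σ) := by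
  have ins : ∀ {Γ Δ : Set (IL L ℕ)} {σ : ℕ → L.Term ℕ} (φ : IL L ℕ), (∀ γ ∈ Γ, γ.subst σ ∈ Δ) →
      ∀ γ ∈ insert φ Γ, γ.subst σ ∈ insert (φ.subst σ) Δ := by
    rintro Γ Δ σ φ h γ (rfl | hγ)
    · exact Set.mem_insert _ _
    · exact Set.mem_insert_of_mem _ (h γ hγ)
  -- replacing the eigenvariable `a` by a fresh variable changes neither the context nor `ψ`
  have upd : ∀ {σ : ℕ → L.Term ℕ} {a : ℕ} (t : L.Term ℕ) {ψ : IL L ℕ}, a ∉ ψ.fv →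
      ψ.subst (Function.update σ a t) = ψ.subst σ := by
    intro σ a t ψ ha
    refine subst_congr fun y hy => ?_
    rw [Function.update_of_ne]
    rintro rfl
    exact ha hy
  have updInst : ∀ {σ : ℕ → L.Term ℕ} {a : ℕ} (t : L.Term ℕ) {ψ : IL L (Option ℕ)},
      a ∉ Finset.eraseNone ψ.fv → (ψ.inst (Term.var a)).subst (Function.update σ a t) =
        (ψ.subst (liftSubst σ)).inst t := by
    intro σ a t ψ ha
    rw [inst_subst, subst_liftSubst_inst]
    simp only [Term.subst, Function.update_self]
    refine subst_congr (extendSubst_congr _ fun y hy => ?_)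
    rw [Function.update_of_ne]
    rintro rfl
    exact ha hy
  induction h generalizing σ Δ with
  | hyp h => exact .hyp (hΔ _ h)
  | botE φ _ ih => exact .botE _ (ih σ Δ hΔ hf)
  | topI => exact .topI
  | andI _ _ ih₁ ih₂ => exact .andI (ih₁ σ Δ hΔ hf) (ih₂ σ Δ hΔ hf)
  | andE₁ _ ih => exact .andE₁ (ih σ Δ hΔ hf)
  | andE₂ _ ih => exact .andE₂ (ih σ Δ hΔ hf)
  | orI₁ _ ih => exact .orI₁ (ih σ Δ hΔ hf)
  | orI₂ _ ih => exact .orI₂ (ih σ Δ hΔ hf)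
  | orE _ _ _ ih ih₁ ih₂ =>
    exact .orE (ih σ Δ hΔ hf) (ih₁ σ _ (ins _ hΔ) (infinite_fresh_insert _ hf))
      (ih₂ σ _ (ins _ hΔ) (infinite_fresh_insert _ hf))
  | impI _ ih => exact .impI (ih σ _ (ins _ hΔ) (infinite_fresh_insert _ hf))
  | impE _ _ ih₁ ih₂ => exact .impE (ih₁ σ Δ hΔ hf) (ih₂ σ Δ hΔ hf)
  | @allI Γ φ a ha haφ _ ih =>
    obtain ⟨b, hb, hb'⟩ := (hf.sdiff (IL.fv (φ.all.subst σ)).finite_toSet).nonempty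
    refine .allI b hb hb' ?_
    have := ih (Function.update σ a (Term.var b)) Δ
      (fun γ hγ => by rw [upd _ (ha γ hγ)]; exact hΔ γ hγ) hf
    rwa [updInst _ haφ] at this
  | @allE Γ φ t _ ih =>
    have := Provable.allE (t.subst σ) (ih σ Δ hΔ hf)
    rwa [subst_liftSubst_inst, ← inst_subst] at this
  | @exI Γ φ t _ ih =>
    refine .exI (t.subst σ) ?_
    rw [subst_liftSubst_inst, ← inst_subst]
    exact ih σ Δ hΔ hf
  | @exE Γ φ ψ a ha haφ haψ _ _ ih₁ ih₂ =>
    obtain ⟨b, hb, hb'⟩ := (hf.sdiff ((IL.fv (φ.ex.subst σ)) ∪ (ψ.subst σ).fv).finite_toSet).nonempty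
    simp only [Finset.coe_union, Set.mem_union, Finset.mem_coe, not_or] at hb'
    refine .exE b hb hb'.1 hb'.2 (ih₁ σ Δ hΔ hf) ?_
    have := ih₂ (Function.update σ a (Term.var b)) (insert ((φ.subst (liftSubst σ)).inst
      (Term.var b)) Δ) (by
        rintro γ (rfl | hγ)
        · rw [updInst _ haφ]
          exact Set.mem_insert _ _
        · rw [upd _ (ha γ hγ)]
          exact Set.mem_insert_of_mem _ (hΔ γ hγ)) (infinite_fresh_insert _ hf)
    rwa [upd _ haψ] at this
  | eqRefl t => exact .eqRefl _
  | @eqSubst Γ s t φ _ _ ih₁ ih₂ =>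
    have h₂ := ih₂ σ Δ hΔ hf
    rw [inst_subst, ← subst_liftSubst_inst] at h₂
    rw [inst_subst, ← subst_liftSubst_inst]
    exact .eqSubst _ (ih₁ σ Δ hΔ hf) h₂

/-- `CT, Γ ⊢ φ` for a finite context `Γ`. -/
def Ent (CT : ConstraintTheory L) (Γ : Multiset (IL L ℕ)) (φ : IL L ℕ) : Prop :=
  IL.Provable (CTAxiom.formula '' CT ∪ {γ | γ ∈ Γ}) φ

variable {CT : ConstraintTheory L} {Γ Γ' : Multiset (IL L ℕ)} {φ ψ : IL L ℕ}

theorem infinite_fresh (CT : ConstraintTheory L) (Γ : Multiset (IL L ℕ)) :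
    {b | ∀ γ ∈ CTAxiom.formula '' CT ∪ {γ | γ ∈ Γ}, b ∉ γ.fv}.Infinite := by
  classical
  refine (Set.infinite_univ.sdiff (Γ.toFinset.biUnion IL.fv).finite_toSet).mono ?_
  rintro b ⟨-, hb⟩ γ (⟨A, -, rfl⟩ | hγ)
  · rw [CTAxiom.formula, IL.fv_closure]
    simp
  · intro h
    exact hb (by simpa using ⟨γ, hγ, h⟩)

theorem Ent.subst (h : Ent CT Γ φ) (σ : ℕ → L.Term ℕ) :
    Ent CT (Γ.map fun γ => γ.subst σ) (φ.subst σ) := by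
  refine IL.Provable.subst h σ _ ?_ (infinite_fresh _ _)
  rintro γ (⟨A, hA, rfl⟩ | hγ)
  · left
    rw [IL.subst_congr (τ := Term.var) (by rw [CTAxiom.formula, IL.fv_closure]; simp), IL.subst_var]
    exact ⟨A, hA, rfl⟩
  · right
    exact Multiset.mem_map_of_mem (fun γ => IL.subst γ σ) hγ

theorem Ent.weaken (h : Ent CT Γ φ) (hΓ : Γ ⊆ Γ') : Ent CT Γ' φ := by
  have := IL.Provable.subst h Term.var (CTAxiom.formula '' CT ∪ {γ | γ ∈ Γ'}) (by
    rintro γ (hγ | hγ)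
    · rw [IL.subst_var]
      exact Or.inl hγ
    · rw [IL.subst_var]
      exact Or.inr (hΓ hγ)) (infinite_fresh _ _)
  rwa [IL.subst_var] at this

theorem insert_context (φ : IL L ℕ) (Γ : Multiset (IL L ℕ)) :
    insert φ (CTAxiom.formula '' CT ∪ {γ | γ ∈ Γ}) =
      CTAxiom.formula '' CT ∪ {γ | γ ∈ φ ::ₘ Γ} := by
  ext γ
  simp only [Set.mem_insert_iff, Set.mem_union, Set.mem_ofPred_eq, Multiset.mem_cons]
  tauto

theorem ent_imp : Ent CT Γ (.imp φ ψ) ↔ Ent CT (φ ::ₘ Γ) ψ := by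
  constructor
  · intro h
    have h' : Ent CT (φ ::ₘ Γ) (.imp φ ψ) := h.weaken (Multiset.subset_cons _ _)
    exact .impE h' (.hyp (Or.inr (Multiset.mem_cons_self _ _)))
  · intro h
    refine .impI ?_
    rw [insert_context]
    exact h

theorem Ent.hyp (h : φ ∈ Γ) : Ent CT Γ φ := IL.Provable.hyp (Or.inr h)

theorem Ent.trans (h : Ent CT Γ φ) (hΓ : ∀ γ ∈ Γ, Ent CT Γ' γ) : Ent CT Γ' φ := by
  have key : ∀ Δ : Multiset (IL L ℕ), (∀ γ ∈ Δ, Ent CT Γ' γ) → Ent CT (Δ + Γ') φ → Ent CT Γ' φ := by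
    intro Δ
    induction Δ using Multiset.induction with
    | empty => simp
    | cons γ Δ ih =>
      intro hΔ h
      rw [Multiset.cons_add] at h
      exact ih (fun γ hγ => hΔ γ (Multiset.mem_cons_of_mem hγ))
        (.impE (ent_imp.2 h) ((hΔ γ (Multiset.mem_cons_self _ _)).weaken
          (Multiset.subset_of_le (Multiset.le_add_left _ _))))
  exact key Γ hΓ (h.weaken (Multiset.subset_of_le (Multiset.le_add_right _ _)))

theorem ent_and : Ent CT Γ (.and φ ψ) ↔ Ent CT Γ φ ∧ Ent CT Γ ψ :=
  ⟨fun h => ⟨.andE₁ h, .andE₂ h⟩, fun h => .andI h.1 h.2⟩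

theorem Ent.top : Ent CT Γ .top := IL.Provable.topI

theorem Ent.of_bot (h : Ent CT Γ .bot) (φ : IL L ℕ) : Ent CT Γ φ := IL.Provable.botE φ h

theorem Ent.eqSubst {s t : L.Term ℕ} (φ : IL L (Option ℕ)) (h : Ent CT Γ (.eq s t))
    (h' : Ent CT Γ (φ.inst s)) : Ent CT Γ (φ.inst t) :=
  IL.Provable.eqSubst φ h h'

theorem Ent.eq_refl (t : L.Term ℕ) : Ent CT Γ (.eq t t) := IL.Provable.eqRefl t

theorem Ent.eq_symm {s t : L.Term ℕ} (h : Ent CT Γ (.eq s t)) : Ent CT Γ (.eq t s) := by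
  have := Ent.eqSubst (.eq (Term.var none) (s.relabel some)) h (by
    simp only [IL.inst, IL.subst, term_subst_relabel, instSubst, Term.subst, term_subst_var]
    exact Ent.eq_refl s)
  simpa only [IL.inst, IL.subst, term_subst_relabel, instSubst, Term.subst, term_subst_var]
    using this

theorem Ent.eq_trans {s t r : L.Term ℕ} (h : Ent CT Γ (.eq s t)) (h' : Ent CT Γ (.eq t r)) :
    Ent CT Γ (.eq s r) := by
  have := Ent.eqSubst (.eq (s.relabel some) (Term.var none)) h' (by
    simpa only [IL.inst, IL.subst, term_subst_relabel, instSubst, Term.subst, term_subst_var]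
      using h)
  simpa only [IL.inst, IL.subst, term_subst_relabel, instSubst, Term.subst, term_subst_var]
    using this

theorem singleSubst_eq_update (x : ℕ) (t : L.Term ℕ) :
    singleSubst x t = Function.update Term.var x t := by
  funext y
  by_cases hy : y = x <;> simp [singleSubst, hy]

theorem Ent.eq_singleSubst {x : ℕ} {t : L.Term ℕ} (h : Ent CT Γ (.eq (Term.var x) t))
    (s : L.Term ℕ) : Ent CT Γ (.eq s (s.subst (singleSubst x t))) := by
  have key : ∀ r : L.Term ℕ, (IL.eq (s.relabel some) (s.subst (bindSubst x))).inst r =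
      .eq s (s.subst (Function.update Term.var x r)) := by
    intro r
    simp only [IL.inst, IL.subst, term_subst_relabel, term_subst_var, term_subst_subst,
      instSubst_eq_extendSubst, extendSubst, bindSubst_extendSubst]
  have := Ent.eqSubst (.eq (s.relabel some) (s.subst (bindSubst x))) h (by
    rw [key, Function.update_eq_self, term_subst_var]
    exact Ent.eq_refl s)
  rw [key, ← singleSubst_eq_update] at this
  exact this

/-- A set of contexts is stable if it is closed under strengthening of the context, contains the
inconsistent contexts, and is local for the covers of `Γ ⊢ ∃ψ` by the contexts `ψ(t), Γ` where `t`
runs through all terms. -/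
structure Stable (CT : ConstraintTheory L) (X : Set (Multiset (IL L ℕ))) : Prop where
  mono {Γ Γ' : Multiset (IL L ℕ)} : Γ ∈ X → (∀ γ ∈ Γ, Ent CT Γ' γ) → Γ' ∈ X
  cover {Γ : Multiset (IL L ℕ)} {ψ : IL L (Option ℕ)} : Ent CT Γ (.ex ψ) →
    (∀ t, ψ.inst t ::ₘ Γ ∈ X) → Γ ∈ X
  bot {Γ : Multiset (IL L ℕ)} : Ent CT Γ .bot → Γ ∈ X

/-- Stability of the set of contexts that are inconsistent or entail a member of `Φ`. One fresh
variable serves all members of `Φ`, so that a cover by the instances of an existential formula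
chooses the same member of `Φ` for the generic instance; this replaces the disjunction property. -/
theorem stable_of_formulas {Φ : Set (IL L ℕ)} (hΦ : ∃ s : Finset ℕ, ∀ φ ∈ Φ, φ.fv ⊆ s) :
    Stable CT {Γ | Ent CT Γ .bot ∨ ∃ φ ∈ Φ, Ent CT Γ φ} where
  mono := by
    rintro Γ Γ' (h | ⟨φ, hφ, h⟩) hΓ
    · exact Or.inl (h.trans hΓ)
    · exact Or.inr ⟨φ, hφ, h.trans hΓ⟩
  cover := by
    intro Γ ψ h hψ
    obtain ⟨s, hs⟩ := hΦ
    obtain ⟨a, ha, ha'⟩ := ((infinite_fresh CT Γ).sdiff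
      ((IL.ex ψ).fv ∪ s).finite_toSet).nonempty
    simp only [Finset.coe_union, Set.mem_union, Finset.mem_coe, not_or] at ha'
    have elim : ∀ φ : IL L ℕ, a ∉ φ.fv → Ent CT (ψ.inst (Term.var a) ::ₘ Γ) φ → Ent CT Γ φ := by
      intro φ haφ h'
      refine .exE a ha ha'.1 haφ h ?_
      rw [insert_context]
      exact h'
    rcases hψ (Term.var a) with h' | ⟨φ, hφ, h'⟩
    · exact Or.inl (elim _ (by simp [IL.fv]) h')
    · exact Or.inr ⟨φ, hφ, elim _ (fun h => ha'.2 (hs φ hφ h)) h'⟩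
  bot h := Or.inl h

theorem stable_ent (φ : IL L ℕ) : Stable CT {Γ | Ent CT Γ φ} := by
  have := stable_of_formulas (CT := CT) (Φ := {φ}) ⟨φ.fv, by simp⟩
  convert this using 1
  ext Γ
  simp only [Set.mem_ofPred_eq, Set.mem_singleton_iff, exists_eq_left]
  exact ⟨Or.inr, fun h => h.elim (fun h => h.of_bot _) id⟩

/-- In a stable set, an existentially quantified constraint may be used by assuming an arbitrary
instance of it. -/
theorem Stable.exs_elim {X : Set (Multiset (IL L ℕ))} (hX : Stable CT X) {xs : Finset ℕ}
    {θ : IL L ℕ} {τ : ℕ → L.Term ℕ} (h : Ent CT Γ ((IL.exs xs θ).subst τ))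
    (H : ∀ τ', (∀ y ∉ xs, τ' y = τ y) → θ.subst τ' ::ₘ Γ ∈ X) : Γ ∈ X := by
  have key : ∀ (l : List ℕ) (τ : ℕ → L.Term ℕ) (Γ : Multiset (IL L ℕ)),
      Ent CT Γ ((l.foldr IL.exVar θ).subst τ) →
      (∀ τ', (∀ y ∉ l, τ' y = τ y) → θ.subst τ' ::ₘ Γ ∈ X) → Γ ∈ X := by
    intro l
    induction l with
    | nil =>
      intro τ Γ h H
      refine hX.mono (H τ fun _ _ => rfl) fun γ hγ => ?_
      rcases Multiset.mem_cons.1 hγ with rfl | hγ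
      · exact h
      · exact Ent.hyp hγ
    | cons x l ih =>
      intro τ Γ h H
      refine hX.cover h fun t => ?_
      rw [IL.exVar_subst_inst]
      refine ih (Function.update τ x t) _ (Ent.hyp (Multiset.mem_cons_self _ _)) fun τ' hτ' => ?_
      refine hX.mono (H τ' fun y hy => ?_) fun γ hγ => Ent.hyp ?_
      · simp only [List.mem_cons, not_or] at hy
        rw [hτ' y hy.2, Function.update_of_ne hy.1]
      · simp only [Multiset.mem_cons] at hγ ⊢
        tauto
  exact key _ τ Γ h fun τ' hτ' => H τ' fun y hy => hτ' y (by simpa using hy)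

theorem Ent.exs_intro {xs : Finset ℕ} {θ : IL L ℕ} {τ τ' : ℕ → L.Term ℕ}
    (h : Ent CT Γ (θ.subst τ')) (hτ : ∀ y ∈ θ.fv, y ∉ xs → τ' y = τ y) :
    Ent CT Γ ((IL.exs xs θ).subst τ) := by
  have key : ∀ (l : List ℕ) (τ τ' : ℕ → L.Term ℕ), (∀ y ∉ l, τ' y = τ y) →
      Ent CT Γ (θ.subst τ') → Ent CT Γ ((l.foldr IL.exVar θ).subst τ) := by
    intro l
    induction l with
    | nil =>
      intro τ τ' hτ h
      rwa [funext fun y => hτ y (by simp)] at h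
    | cons x l ih =>
      intro τ τ' hτ h
      refine .exI (τ' x) ?_
      rw [IL.exVar_subst_inst]
      refine ih _ τ' (fun y hy => ?_) h
      by_cases hyx : y = x
      · subst hyx
        rw [Function.update_self]
      · rw [Function.update_of_ne hyx]
        exact hτ y (by simp [hyx, hy])
  refine key _ τ (fun y => if y ∈ xs then τ' y else τ y) (fun y hy => ?_) ?_
  · have : y ∉ xs := by simpa using hy
    simp [this]
  · rwa [IL.subst_congr (τ := τ')]
    intro y hy
    by_cases hyx : y ∈ xs
    · simp [hyx]
    · simp [hyx, hτ y hy hyx]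

/-- An implication follows from `CT` once it holds in all contexts and under all assignments. -/
theorem entails_imp_of_forces (h : ∀ (Γ : Multiset (IL L ℕ)) (τ : ℕ → L.Term ℕ),
    Ent CT Γ (φ.subst τ) → Ent CT Γ (ψ.subst τ)) : CT.Entails (.imp φ ψ) := by
  have : Ent CT 0 (.imp φ ψ) := by
    rw [ent_imp]
    have := h {φ} Term.var (by rw [IL.subst_var]; exact Ent.hyp (by simp))
    rwa [IL.subst_var] at this
  simpa [Ent, ConstraintTheory.Entails] using this

theorem forces_of_entails_imp (h : CT.Entails (.imp φ ψ)) (τ : ℕ → L.Term ℕ)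
    (hφ : Ent CT Γ (φ.subst τ)) : Ent CT Γ (ψ.subst τ) := by
  have h₀ : Ent CT 0 (.imp φ ψ) := by simpa [Ent, ConstraintTheory.Entails] using h
  have h₁ : Ent CT Γ (.imp (φ.subst τ) (ψ.subst τ)) := (h₀.subst τ).weaken (by simp)
  exact .impE h₁ hφ

theorem entails_iff_of_forces
    (h : ∀ (Γ : Multiset (IL L ℕ)) (τ : ℕ → L.Term ℕ),
      Ent CT Γ (φ.subst τ) ↔ Ent CT Γ (ψ.subst τ)) : CT.Entails (.iff φ ψ) :=
  .andI (entails_imp_of_forces fun Γ τ => (h Γ τ).1) (entails_imp_of_forces fun Γ τ => (h Γ τ).2)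

theorem BAtom.fv_toIL (b : BAtom L) : b.toIL.fv = b.vars := by
  cases b <;> rfl

theorem Builtin.fv_toIL (B : Builtin L) : B.toIL.fv = B.vars := by
  induction B with
  | top => rfl
  | atom b => exact b.fv_toIL
  | and B B' h h' => simp only [toIL, IL.fv, vars, h, h']

end Entailment

/-! ### Equivalent states have interderivable readings -/

section Soundness

variable {L : FirstOrder.Language.{u, v}} {P : ℕ → Type w}

namespace ILL

variable {Ax : Set (Sequent L P)} {Γ : Multiset (ILL L P ℕ)} {φ φ' ψ ψ' χ : ILL L P ℕ}

theorem Provable.comp (h : Provable Ax {φ} ψ) (h' : Provable Ax {ψ} χ) : Provable Ax {φ} χ := by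
  have := Provable.cut (Δ := 0) h h'
  rwa [add_zero] at this

theorem Provable.tensor_mono (h : Provable Ax {φ} φ') (h' : Provable Ax {ψ} ψ') :
    Provable Ax {tensor φ ψ} (tensor φ' ψ') :=
  Provable.tensorL (Γ := 0) (Provable.tensorR h h')

theorem Provable.tensor_comm (φ ψ : ILL L P ℕ) : Provable Ax {tensor φ ψ} (tensor ψ φ) := by
  refine Provable.tensorL (Γ := 0) ?_
  rw [Multiset.cons_swap]
  exact Provable.tensorR (.identity ψ) (.identity φ)

theorem Provable.tensor_assoc (φ ψ χ : ILL L P ℕ) :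
    Provable Ax {tensor (tensor φ ψ) χ} (tensor φ (tensor ψ χ)) :=
  Provable.tensorL (Γ := 0) (Provable.tensorL
    (Provable.tensorR (.identity φ) (Provable.tensorR (.identity ψ) (.identity χ))))

theorem Provable.tensor_assoc' (φ ψ χ : ILL L P ℕ) :
    Provable Ax {tensor φ (tensor ψ χ)} (tensor (tensor φ ψ) χ) := by
  refine Provable.tensorL (Γ := 0) ?_
  rw [Multiset.cons_swap]
  refine Provable.tensorL ?_
  have := Provable.tensorR (Provable.tensorR (.identity φ) (.identity ψ))
    (Provable.identity (Ax := Ax) χ)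
  convert this using 1
  simp only [← Multiset.singleton_add]
  abel

/-- An inconsistent formula `φ ⊗ 0` entails everything. -/
theorem Provable.of_tensor_zero (φ ψ : ILL L P ℕ) : Provable Ax {tensor φ zero} ψ := by
  refine Provable.tensorL (Γ := 0) ?_
  have h₁ : Provable Ax {zero} (lolli φ ψ) := .zeroL _
  have h₂ : Provable Ax (lolli φ ψ ::ₘ ({φ} + 0)) ψ := .lolliL (.identity φ) (.identity ψ)
  have := Provable.cut h₁ h₂
  convert this using 1
  simp only [← Multiset.singleton_add]
  abel

theorem Provable.exs_left {xs : Finset ℕ} (h : Provable Ax (φ ::ₘ Γ) ψ)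
    (hΓ : ∀ x ∈ xs, ∀ γ ∈ Γ, x ∉ γ.fv) (hψ : ∀ x ∈ xs, x ∉ ψ.fv) :
    Provable Ax (exs xs φ ::ₘ Γ) ψ := by
  have key : ∀ l : List ℕ, (∀ x ∈ l, x ∈ xs) → Provable Ax (l.foldr exVar φ ::ₘ Γ) ψ := by
    intro l
    induction l with
    | nil => exact fun _ => h
    | cons x l ih =>
      intro hl
      have hx := hl x (by simp)
      -- the bound variable itself serves as the eigenvariable
      refine Provable.exL x (hΓ x hx) (fun hb => (mem_fv_exVar hb).2 rfl) (hψ x hx) ?_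
      rw [bindSubst_inst]
      exact ih fun y hy => hl y (by simp [hy])
  exact key _ (by simp)

theorem Provable.exs_right {xs : Finset ℕ} (h : Provable Ax Γ φ) : Provable Ax Γ (exs xs φ) := by
  have key : ∀ l : List ℕ, Provable Ax Γ (l.foldr exVar φ) := by
    intro l
    induction l with
    | nil => exact h
    | cons x l ih =>
      refine Provable.exR (Term.var x) ?_
      rw [bindSubst_inst]
      exact ih
  exact key _

theorem Provable.exs_mono (xs : Finset ℕ) (h : Provable Ax {φ} ψ) :
    Provable Ax {exs xs φ} (exs xs ψ) :=
  Provable.exs_left (Γ := 0) (Provable.exs_right h) (by simp) fun _ hx hb => (mem_fv_exs hb).2 hx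

theorem EquivMod.symm (h : EquivMod Ax φ ψ) : EquivMod Ax ψ φ := ⟨h.2, h.1⟩

theorem EquivMod.trans (h : EquivMod Ax φ ψ) (h' : EquivMod Ax ψ χ) : EquivMod Ax φ χ :=
  ⟨h.1.comp h'.1, h'.2.comp h.2⟩

end ILL

open ILL

theorem BAtom.fv_toILL (b : BAtom L) : (b.toILL P).fv = b.vars := by
  cases b <;> rfl

theorem Goal.fv_toILL (G : Goal L P) : G.toILL.fv = G.vars := by
  induction G with
  | top => rfl
  | user c ts => rfl
  | builtin b => exact b.fv_toILL
  | and G G' h h' => simp only [toILL, ILL.fv, vars, h, h']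

theorem Builtin.vars_toGoal (B : Builtin L) : (B.toGoal P).vars = B.vars := by
  induction B with
  | top => rfl
  | atom b => rfl
  | and B B' h h' => simp only [toGoal, Goal.vars, vars, h, h']

theorem UserC.vars_toGoal (U : UserC L P) : U.toGoal.vars = U.vars := by
  induction U with
  | top => rfl
  | atom c ts => rfl
  | and U U' h h' => simp only [toGoal, Goal.vars, vars, h, h']

theorem State.localVars_normal (U : UserC L P) (B : Builtin L) (V : Finset ℕ) :
    (State.normal U B V).localVars = (U.vars ∪ B.vars) \ V := by
  simp only [State.normal, State.localVars, Goal.vars, U.vars_toGoal, B.vars_toGoal]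

theorem strictlyLocal_eq (U : UserC L P) (B : Builtin L) (V : Finset ℕ) :
    strictlyLocal U B V = B.vars \ (V ∪ U.vars) := by
  rw [strictlyLocal, State.localVars_normal]
  ext x
  simp only [Finset.mem_sdiff, Finset.mem_union]
  tauto

theorem GoalEquiv.vars_eq {G G' : Goal L P} (h : GoalEquiv G G') : G.vars = G'.vars := by
  induction h with
  | refl G => rfl
  | symm _ ih => exact ih.symm
  | trans _ _ ih ih' => exact ih.trans ih'
  | congr _ _ ih ih' => simp only [Goal.vars, ih, ih']
  | assoc G₁ G₂ G₃ => simp only [Goal.vars, Finset.union_assoc]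
  | comm G₁ G₂ => simp only [Goal.vars, Finset.union_comm]
  | top_and G => simp [Goal.vars]

theorem GoalEquiv.equivMod (Ax : Set (Sequent L P)) {G G' : Goal L P} (h : GoalEquiv G G') :
    EquivMod Ax G.toILL G'.toILL := by
  induction h with
  | refl G => exact ⟨.identity _, .identity _⟩
  | symm _ ih => exact ih.symm
  | trans _ _ ih ih' => exact ih.trans ih'
  | congr _ _ ih ih' => exact ⟨ih.1.tensor_mono ih'.1, ih.2.tensor_mono ih'.2⟩
  | assoc G₁ G₂ G₃ => exact ⟨.tensor_assoc _ _ _, .tensor_assoc' _ _ _⟩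
  | comm G₁ G₂ => exact ⟨.tensor_comm _ _, .tensor_comm _ _⟩
  | top_and G =>
    refine ⟨Provable.tensorL (Γ := 0) (Provable.oneL (.identity _)), ?_⟩
    have := Provable.tensorR Provable.oneR (Provable.identity (Ax := Ax) G.toILL)
    rwa [zero_add] at this

/-- Interderivable goals with the same variables yield interderivable states. -/
theorem equivMod_state_of_goal {Ax : Set (Sequent L P)} {G G' : Goal L P} (V : Finset ℕ)
    (hv : G.vars = G'.vars) (h : EquivMod Ax G.toILL G'.toILL) :
    EquivMod Ax (State.toILL ⟨G, V⟩) (State.toILL ⟨G', V⟩) := by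
  simp only [State.toILL, State.localVars, hv]
  exact ⟨h.1.exs_mono _, h.2.exs_mono _⟩

/-- The arguments of a user-defined atom are replaced one at a time by the axioms of `Σ_≐`. -/
theorem provable_user_of_eq {Ax : Set (Sequent L P)} (hAx : sigmaEq L P ⊆ Ax) {ε : ILL L P ℕ}
    {n : ℕ} (c : P n) (ts ss : Fin n → L.Term ℕ)
    (h : ∀ j, Provable Ax {bang ε} (bang (.eq (ts j) (ss j)))) :
    Provable Ax (bang ε ::ₘ {user c ts}) (user c ss) := by
  have key : ∀ J : Finset (Fin n),
      Provable Ax (bang ε ::ₘ {user c ts}) (user c (J.piecewise ss ts)) := by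
    intro J
    induction J using Finset.induction with
    | empty =>
      rw [Finset.piecewise_empty]
      exact Provable.weakening (.identity _)
    | insert j J hj ih =>
      rw [Finset.piecewise_insert]
      set rs := J.piecewise ss ts with hrs
      have hrj : rs j = ts j := by rw [hrs, Finset.piecewise_eq_of_notMem _ _ _ hj]
      have ax : Provable Ax {tensor (user c rs) (bang (.eq (rs j) (ss j)))}
          (tensor (user c (Function.update rs j (ss j))) (bang (.eq (rs j) (ss j)))) :=
        .proper (hAx ⟨n, c, rs, j, ss j, rfl⟩)
      have proj : Provable Ax {tensor (user c (Function.update rs j (ss j)))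
          (bang (.eq (rs j) (ss j)))} (user c (Function.update rs j (ss j))) := by
        refine Provable.tensorL (Γ := 0) ?_
        rw [Multiset.cons_swap]
        exact Provable.weakening (.identity _)
      have hb := h j
      rw [← hrj] at hb
      have step := (Provable.tensorR ih hb).cut (Δ := 0) (ax.comp proj)
      have : Provable Ax (bang ε ::ₘ bang ε ::ₘ {user c ts})
          (user c (Function.update rs j (ss j))) := by
        convert step using 1
        simp only [← Multiset.singleton_add]
        abel
      exact this.contraction
  have := key Finset.univ
  rwa [Finset.piecewise_univ] at this

/-- A premise `!ε` that yields the equations `s ≐ s[x / t]` in both orientations makes `𝕌` and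
`𝕌[x / t]` interderivable. -/
theorem provable_userC_subst {Ax : Set (Sequent L P)} (hAx : sigmaEq L P ⊆ Ax) {ε : ILL L P ℕ}
    (x : ℕ) (t : L.Term ℕ)
    (h : ∀ s : L.Term ℕ, Provable Ax {bang ε} (bang (.eq s (s.subst (singleSubst x t)))))
    (h' : ∀ s : L.Term ℕ, Provable Ax {bang ε} (bang (.eq (s.subst (singleSubst x t)) s)))
    (U : UserC L P) :
    Provable Ax (bang ε ::ₘ {U.toGoal.toILL}) (U.subst x t).toGoal.toILL ∧
      Provable Ax (bang ε ::ₘ {(U.subst x t).toGoal.toILL}) U.toGoal.toILL := by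
  have tens : ∀ {φ φ' ψ ψ' : ILL L P ℕ}, Provable Ax (bang ε ::ₘ {φ}) φ' →
      Provable Ax (bang ε ::ₘ {ψ}) ψ' →
      Provable Ax (bang ε ::ₘ {tensor φ ψ}) (tensor φ' ψ') := by
    intro φ φ' ψ ψ' h₁ h₂
    refine Provable.contraction ?_
    have := Provable.tensorR h₁ h₂
    have h₃ : Provable Ax (tensor φ ψ ::ₘ bang ε ::ₘ {bang ε}) (tensor φ' ψ') := by
      refine Provable.tensorL ?_
      convert this using 1
      simp only [← Multiset.singleton_add]
      abel
    convert h₃ using 1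
    simp only [← Multiset.singleton_add]
    abel
  induction U with
  | top => exact ⟨.weakening (.identity _), .weakening (.identity _)⟩
  | atom c ts =>
    exact ⟨provable_user_of_eq hAx c _ _ fun j => h (ts j),
      provable_user_of_eq hAx c _ _ fun j => h' (ts j)⟩
  | and U U' ih ih' => exact ⟨tens ih.1 ih'.1, tens ih.2 ih'.2⟩

theorem mem_vars_userC_subst {x : ℕ} {t : L.Term ℕ} {U : UserC L P} {y : ℕ} :
    y ∈ (U.subst x t).vars ↔ (y ∈ U.vars ∧ y ≠ x) ∨ (x ∈ U.vars ∧ y ∈ t.varFinset) := by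
  induction U with
  | top => simp [UserC.subst, UserC.vars]
  | atom c ts =>
    simp only [UserC.subst, UserC.vars, Finset.mem_biUnion, Finset.mem_univ, true_and,
      mem_varFinset_subst]
    constructor
    · rintro ⟨i, a, ha, hy⟩
      unfold singleSubst at hy
      split_ifs at hy with hax
      · subst hax
        exact Or.inr ⟨⟨i, ha⟩, hy⟩
      · simp only [Term.varFinset, Finset.mem_singleton] at hy
        subst hy
        exact Or.inl ⟨⟨i, ha⟩, hax⟩
    · rintro (⟨⟨i, hi⟩, hyx⟩ | ⟨⟨i, hi⟩, hy⟩)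
      · exact ⟨i, y, hi, by simp [singleSubst, hyx, Term.varFinset]⟩
      · exact ⟨i, x, hi, by simpa [singleSubst] using hy⟩
  | and U U' ih ih' =>
    simp only [UserC.subst, UserC.vars, Finset.mem_union, ih, ih']
    grind

theorem provable_sigmaCT {CT : ConstraintTheory L} {Ax : Set (Sequent L P)}
    (hAx : sigmaCT P CT ⊆ Ax) {xs xs' : Finset ℕ} {B B' : Builtin L}
    (h : CT.Entails (.imp (.exs xs B.toIL) (.exs xs' B'.toIL))) :
    Provable Ax {exs xs (B.toILL P)} (exs xs' (B'.toILL P)) :=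
  .proper (hAx ⟨xs, B, xs', B', h, rfl⟩)

/-- An entailment between the built-in constraints, strictly local variables being quantified,
carries over to the states: the strictly local variables are the ones whose quantifier can be pushed
inside to the built-in constraint. -/
theorem provable_theory {CT : ConstraintTheory L} {Ax : Set (Sequent L P)}
    (hAx : sigmaCT P CT ⊆ Ax) (U : UserC L P) (B B' : Builtin L) (V : Finset ℕ)
    (h : CT.Entails (IL.imp (IL.exs (strictlyLocal U B V) B.toIL)
      (IL.exs (strictlyLocal U B' V) B'.toIL))) :
    Provable Ax {(State.normal U B V).toILL} (State.normal U B' V).toILL := by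
  have fvU : ∀ {y}, y ∈ U.toGoal.toILL.fv → y ∈ U.vars := fun hy => by
    rwa [Goal.fv_toILL, U.vars_toGoal] at hy
  have fvN : ∀ {B : Builtin L} {y}, y ∈ (State.normal U B V).goal.toILL.fv →
      y ∈ U.vars ∪ B.vars := fun hy => by
    rwa [Goal.fv_toILL, State.normal, Goal.vars, U.vars_toGoal, Builtin.vars_toGoal] at hy
  refine Provable.exs_left (Γ := 0) ?_ (by simp) fun y hy hy' => ?_
  · refine Provable.tensorL (Γ := 0) ?_
    have h₁ : Provable Ax {B.toILL P} (exs (strictlyLocal U B' V) (B'.toILL P)) :=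
      (Provable.exs_right (.identity _)).comp (provable_sigmaCT hAx h)
    have h₂ : Provable Ax (exs (strictlyLocal U B' V) (B'.toILL P) ::ₘ {U.toGoal.toILL})
        (State.normal U B' V).toILL := by
      refine Provable.exs_left ?_ (fun y hy γ hγ hy' => ?_) fun y hy hy' => ?_
      · refine Provable.exs_right ?_
        have := Provable.tensorR (Provable.identity (Ax := Ax) U.toGoal.toILL)
          (.identity (B'.toILL P))
        rwa [Multiset.singleton_add, ← Multiset.cons_zero, Multiset.cons_swap] at this
      · rw [Multiset.mem_singleton.1 hγ] at hy'
        exact (Finset.mem_sdiff.1 hy).2 (fvU hy')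
      · exact (mem_fv_exs hy').2 (Finset.mem_sdiff.1 hy).1
    have := h₁.cut h₂
    rwa [Multiset.singleton_add, ← Multiset.cons_zero, Multiset.cons_swap] at this
  · obtain ⟨h₁, h₂⟩ := mem_fv_exs hy'
    rw [State.localVars_normal] at hy h₂
    exact h₂ (Finset.mem_sdiff.2 ⟨fvN h₁, (Finset.mem_sdiff.1 hy).2⟩)

/-- Equivalent states have interderivable readings, clause by clause of the state equivalence. -/
theorem StateEquiv.equivMod {CT : ConstraintTheory L} {S T : State L P} (h : StateEquiv CT S T) :
    EquivMod (sigmaCT P CT ∪ sigmaEq L P) S.toILL T.toILL := by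
  have hCT : sigmaCT P CT ⊆ sigmaCT P CT ∪ sigmaEq L P := Set.subset_union_left
  induction h with
  | refl S => exact ⟨.identity _, .identity _⟩
  | symm _ ih => exact ih.symm
  | trans _ _ ih ih' => exact ih.trans ih'
  | goal V h => exact equivMod_state_of_goal V h.vars_eq (h.equivMod _)
  | subst U x t B V =>
    have eqs : ∀ s s' : L.Term ℕ, (∀ Γ τ, Ent CT Γ (.eq (τ x) (t.subst τ)) →
        Ent CT Γ (.eq (s.subst τ) (s'.subst τ))) →
        Provable (sigmaCT P CT ∪ sigmaEq L P) {bang (.eq (Term.var x) t)} (bang (.eq s s')) := by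
      intro s s' h
      have := provable_sigmaCT (P := P) hCT (xs := ∅) (xs' := ∅)
        (B := .atom (.eq (Term.var x) t)) (B' := .atom (.eq s s')) (CT := CT) (by
          simp only [IL.exs, Finset.sort_empty, List.foldr_nil]
          exact entails_imp_of_forces h)
      simp only [ILL.exs, Finset.sort_empty, List.foldr_nil] at this
      exact this
    have base : ∀ (s : L.Term ℕ) (Γ τ), Ent CT Γ (.eq (τ x) (t.subst τ)) →
        Ent CT Γ (.eq (s.subst τ) ((s.subst (singleSubst x t)).subst τ)) := by
      intro s Γ τ h
      have : CT.Entails (.imp (.eq (Term.var x) t) (.eq s (s.subst (singleSubst x t)))) := by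
        have : Ent CT 0 (.imp (.eq (Term.var x) t) (.eq s (s.subst (singleSubst x t)))) :=
          ent_imp.2 (Ent.eq_singleSubst (Ent.hyp (Multiset.mem_cons_self _ _)) s)
        simpa [Ent, ConstraintTheory.Entails] using this
      exact forces_of_entails_imp this τ h
    obtain ⟨h₁, h₂⟩ := provable_userC_subst (Ax := sigmaCT P CT ∪ sigmaEq L P)
      Set.subset_union_right x t (fun s => eqs _ _ (base s))
      (fun s => eqs _ _ fun Γ τ h => (base s Γ τ h).eq_symm) U
    have tens : ∀ {φ φ' ε β : ILL L P ℕ}, Provable (sigmaCT P CT ∪ sigmaEq L P) (bang ε ::ₘ {φ}) φ' →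
        Provable (sigmaCT P CT ∪ sigmaEq L P) {tensor φ (tensor (bang ε) β)}
          (tensor φ' (tensor (bang ε) β)) := by
      intro φ φ' ε β h
      refine Provable.tensorL (Γ := 0) ?_
      rw [Multiset.cons_swap]
      refine Provable.tensorL (Provable.contraction ?_)
      have := h.tensorR (Provable.tensorR (.identity (bang ε)) (.identity β))
      convert this using 1
      simp only [← Multiset.singleton_add]
      abel
    refine equivMod_state_of_goal V ?_ ⟨tens h₁, tens h₂⟩
    ext y
    simp only [Goal.vars, UserC.vars_toGoal, Builtin.toGoal, Finset.mem_union, BAtom.vars,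
      Term.varFinset, Finset.mem_singleton, mem_vars_userC_subst]
    by_cases hyx : y = x
    · simp [hyx]
    · by_cases hyt : y ∈ t.varFinset <;> simp [hyx, hyt]
  | theory U B B' V h =>
    exact ⟨provable_theory hCT U B B' V (.andE₁ h), provable_theory hCT U B' B V (.andE₂ h)⟩
  | global G x V hx =>
    have : State.localVars ⟨G, {x} ∪ V⟩ = State.localVars ⟨G, V⟩ := by
      ext y
      simp only [State.localVars, Finset.mem_sdiff, Finset.mem_union, Finset.mem_singleton]
      constructor
      · tauto
      · rintro ⟨h₁, h₂⟩
        refine ⟨h₁, ?_⟩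
        rintro (rfl | h)
        · exact hx h₁
        · exact h₂ h
    simp only [State.toILL, this]
    exact ⟨.identity _, .identity _⟩
  | failed G G' V V' =>
    have key : ∀ (G : Goal L P) (V : Finset ℕ) (ψ : ILL L P ℕ),
        Provable (sigmaCT P CT ∪ sigmaEq L P)
          {State.toILL ⟨.and G (.builtin .bot), V⟩} ψ := by
      intro G V ψ
      have : Provable (sigmaCT P CT ∪ sigmaEq L P)
          {State.toILL ⟨.and G (.builtin .bot), V⟩} ILL.zero :=
        Provable.exs_left (Γ := 0) (Provable.of_tensor_zero _ _) (by simp) (by simp [ILL.fv])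
      exact this.comp (.zeroL ψ)
    exact ⟨key _ _ _, key _ _ _⟩

end Soundness

/-! ### User-defined atoms -/

section Atoms

variable {L : FirstOrder.Language.{u, v}} {P : ℕ → Type w}

/-- An atomic user-defined constraint `c_u(t₁, …, tₙ)`. -/
structure UAtom (L : FirstOrder.Language.{u, v}) (P : ℕ → Type w) : Type (max u w) where
  arity : ℕ
  sym : P arity
  args : Fin arity → L.Term ℕ

namespace UAtom

/-- Simultaneous substitution in an atom. -/
def subst (τ : ℕ → L.Term ℕ) (a : UAtom L P) : UAtom L P :=
  ⟨a.arity, a.sym, fun i => (a.args i).subst τ⟩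

/-- The variables of an atom. -/
def vars (a : UAtom L P) : Finset ℕ := Finset.univ.biUnion fun i => (a.args i).varFinset

theorem subst_subst (a : UAtom L P) (σ τ : ℕ → L.Term ℕ) :
    (a.subst σ).subst τ = a.subst fun y => (σ y).subst τ := by
  simp only [subst, term_subst_subst]

theorem subst_congr {a : UAtom L P} {σ τ : ℕ → L.Term ℕ} (h : ∀ y ∈ a.vars, σ y = τ y) :
    a.subst σ = a.subst τ := by
  simp only [subst, mk.injEq, heq_eq_eq, true_and]
  funext i
  exact term_subst_congr fun y hy => h y (Finset.mem_biUnion.2 ⟨i, Finset.mem_univ _, hy⟩)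

theorem subst_var (a : UAtom L P) : a.subst Term.var = a := by
  simp only [subst, term_subst_var]

/-- The atoms `a` and `b` have the same symbol, and `CT, Γ` entails that their arguments are
equal. -/
inductive Eqv (CT : ConstraintTheory L) (Γ : Multiset (IL L ℕ)) : UAtom L P → UAtom L P → Prop
  | mk {n : ℕ} (c : P n) (ts ss : Fin n → L.Term ℕ) :
      (∀ i, Ent CT Γ (.eq (ts i) (ss i))) → Eqv CT Γ ⟨n, c, ts⟩ ⟨n, c, ss⟩

variable {CT : ConstraintTheory L} {Γ Γ' : Multiset (IL L ℕ)} {a b c : UAtom L P}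

theorem Eqv.refl (a : UAtom L P) : Eqv CT Γ a a := .mk _ _ _ fun _ => Ent.eq_refl _

theorem Eqv.symm (h : Eqv CT Γ a b) : Eqv CT Γ b a := by
  obtain ⟨_, _, _, h⟩ := h
  exact .mk _ _ _ fun i => (h i).eq_symm

theorem Eqv.trans (h : Eqv CT Γ a b) (h' : Eqv CT Γ b c) : Eqv CT Γ a c := by
  obtain ⟨_, _, _, h⟩ := h
  obtain ⟨_, _, _, h'⟩ := h'
  exact .mk _ _ _ fun i => (h i).eq_trans (h' i)

theorem Eqv.mono (h : Eqv CT Γ a b) (hΓ : ∀ γ ∈ Γ, Ent CT Γ' γ) : Eqv CT Γ' a b := by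
  obtain ⟨_, _, _, h⟩ := h
  exact .mk _ _ _ fun i => (h i).trans hΓ

end UAtom

/-- A finite conjunction of built-in constraints. -/
def Builtin.conj : List (Builtin L) → Builtin L
  | [] => .top
  | B :: Bs => .and B (conj Bs)

theorem ent_conj {CT : ConstraintTheory L} {Γ : Multiset (IL L ℕ)} {τ : ℕ → L.Term ℕ}
    {Bs : List (Builtin L)} : Ent CT Γ ((Builtin.conj Bs).toIL.subst τ) ↔
      ∀ B ∈ Bs, Ent CT Γ (B.toIL.subst τ) := by
  induction Bs with
  | nil => exact ⟨fun _ => by simp, fun _ => Ent.top⟩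
  | cons B Bs ih =>
    simp only [Builtin.conj, Builtin.toIL, IL.subst, ent_and, ih, List.mem_cons, forall_eq_or_imp]

theorem vars_conj_subset {Bs : List (Builtin L)} {s : Finset ℕ} (h : ∀ B ∈ Bs, B.vars ⊆ s) :
    (Builtin.conj Bs).vars ⊆ s := by
  induction Bs with
  | nil => simp [Builtin.conj, Builtin.vars]
  | cons B Bs ih =>
    simp only [List.mem_cons, forall_eq_or_imp] at h
    exact Finset.union_subset h.1 (ih h.2)

namespace UAtom

open Classical in
/-- The built-in constraint stating that two atoms are equal; it is `⊥` if their symbols differ. -/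
noncomputable def eqs (a b : UAtom L P) : Builtin L :=
  if h : (⟨a.arity, a.sym⟩ : Σ n, P n) = ⟨b.arity, b.sym⟩ then
    .conj (List.ofFn fun i =>
      .atom (.eq (a.args i) (b.args (Fin.cast (congrArg Sigma.fst h) i))))
  else .atom .bot

variable {CT : ConstraintTheory L} {Γ : Multiset (IL L ℕ)}

theorem ent_eqs {a b : UAtom L P} {τ : ℕ → L.Term ℕ} :
    Ent CT Γ ((a.eqs b).toIL.subst τ) ↔
      Ent CT Γ .bot ∨ Eqv CT Γ (a.subst τ) (b.subst τ) := by
  obtain ⟨n, c, ts⟩ := a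
  obtain ⟨m, d, ss⟩ := b
  by_cases h : (⟨n, c⟩ : Σ n, P n) = ⟨m, d⟩
  · obtain ⟨rfl, h'⟩ := Sigma.mk.inj_iff.1 h
    obtain rfl := eq_of_heq h'
    simp only [eqs, dif_pos, ent_conj, List.mem_ofFn, forall_exists_index,
      forall_apply_eq_imp_iff, Fin.cast_eq_self]
    constructor
    · exact fun h => Or.inr (.mk _ _ _ h)
    · rintro (h | h)
      · exact fun i => h.of_bot _
      · cases h with
        | mk _ _ _ h => exact h
  · simp only [eqs, dif_neg h]
    constructor
    · exact Or.inl
    · rintro (h' | h')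
      · exact h'
      · generalize ha : (⟨n, c, ts⟩ : UAtom L P).subst τ = a at h'
        generalize hb : (⟨m, d, ss⟩ : UAtom L P).subst τ = b at h'
        obtain ⟨c', _, _, _⟩ := h'
        simp only [subst, UAtom.mk.injEq] at ha hb
        obtain ⟨rfl, hc, -⟩ := ha
        obtain ⟨rfl, hd, -⟩ := hb
        exact absurd (by rw [eq_of_heq hc, eq_of_heq hd]) h

theorem vars_eqs (a b : UAtom L P) : (a.eqs b).vars ⊆ a.vars ∪ b.vars := by
  unfold eqs
  split_ifs with h
  · refine vars_conj_subset fun B hB => ?_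
    obtain ⟨i, rfl⟩ := (List.mem_ofFn' _ _).1 hB
    refine Finset.union_subset_union (fun y hy => ?_) (fun y hy => ?_)
    · exact Finset.mem_biUnion.2 ⟨i, Finset.mem_univ _, hy⟩
    · exact Finset.mem_biUnion.2 ⟨_, Finset.mem_univ _, hy⟩
  · simp [Builtin.vars, BAtom.vars]

/-- The built-in constraint stating that two lists of atoms are pairwise equal; it is `⊥` if their
lengths differ. -/
noncomputable def eqsList : List (UAtom L P) → List (UAtom L P) → Builtin L
  | [], [] => .top
  | a :: as, b :: bs => .and (a.eqs b) (eqsList as bs)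
  | _, _ => .atom .bot

theorem ent_eqsList {as bs : List (UAtom L P)} {τ : ℕ → L.Term ℕ} :
    Ent CT Γ ((eqsList as bs).toIL.subst τ) ↔ Ent CT Γ .bot ∨
      List.Forall₂ (fun a b => Eqv CT Γ (a.subst τ) (b.subst τ)) as bs := by
  induction as generalizing bs with
  | nil =>
    cases bs with
    | nil => exact ⟨fun _ => Or.inr .nil, fun _ => Ent.top⟩
    | cons b bs =>
      simp only [eqsList, Builtin.toIL, BAtom.toIL, IL.subst]
      exact ⟨Or.inl, fun h => h.elim id nofun⟩
  | cons a as ih =>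
    cases bs with
    | nil =>
      simp only [eqsList, Builtin.toIL, BAtom.toIL, IL.subst]
      exact ⟨Or.inl, fun h => h.elim id nofun⟩
    | cons b bs =>
      simp only [eqsList, Builtin.toIL, IL.subst, ent_and, ih, ent_eqs, List.forall₂_cons]
      tauto

theorem vars_eqsList {as bs : List (UAtom L P)} {s : Finset ℕ} (ha : ∀ a ∈ as, a.vars ⊆ s)
    (hb : ∀ b ∈ bs, b.vars ⊆ s) : (eqsList as bs).vars ⊆ s := by
  induction as generalizing bs with
  | nil => cases bs <;> simp [eqsList, Builtin.vars, BAtom.vars]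
  | cons a as ih =>
    cases bs with
    | nil => simp [eqsList, Builtin.vars, BAtom.vars]
    | cons b bs =>
      simp only [List.mem_cons, forall_eq_or_imp] at ha hb
      exact Finset.union_subset ((vars_eqs a b).trans (Finset.union_subset ha.1 hb.1))
        (ih ha.2 hb.2)

end UAtom

end Atoms

/-! ### Phase semantics -/

section PhaseSemantics

open scoped Pointwise

variable {L : FirstOrder.Language.{u, v}} {P : ℕ → Type w}

/-- A world consists of a multiset of user-defined atoms and a finite context of formulas over the
built-in symbols. Worlds form a commutative monoid under componentwise union. -/
abbrev World (L : FirstOrder.Language.{u, v}) (P : ℕ → Type w) : Type (max u v w 1) :=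
  Multiset (UAtom L P) × Multiset (IL L ℕ)

/-- A set of worlds is closed if all its fibres over the multisets of atoms are stable. -/
def Closed (CT : ConstraintTheory L) (X : Set (World L P)) : Prop :=
  ∀ M, Stable CT {Γ | (M, Γ) ∈ X}

/-- The closure of a set of worlds. -/
def cl (CT : ConstraintTheory L) (X : Set (World L P)) : Set (World L P) :=
  {w | ∀ Z, Closed CT Z → X ⊆ Z → w ∈ Z}

variable {CT : ConstraintTheory L} {X Y Z : Set (World L P)}

theorem subset_cl (CT : ConstraintTheory L) (X : Set (World L P)) : X ⊆ cl CT X :=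
  fun _ hw _ _ hX => hX hw

theorem cl_subset (hZ : Closed CT Z) (h : X ⊆ Z) : cl CT X ⊆ Z := fun _ hw => hw Z hZ h

theorem closed_cl (CT : ConstraintTheory L) (X : Set (World L P)) : Closed CT (cl CT X) := by
  intro M
  refine ⟨?_, ?_, ?_⟩
  · exact fun h hΓ Z hZ hX => (hZ M).mono (h Z hZ hX) hΓ
  · exact fun h hψ Z hZ hX => (hZ M).cover h fun t => hψ t Z hZ hX
  · exact fun h Z hZ hX => (hZ M).bot h

theorem Closed.translate (hZ : Closed CT Z) (x : World L P) : Closed CT {w | w + x ∈ Z} := by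
  intro M
  obtain ⟨M', Γ'⟩ := x
  refine ⟨?_, ?_, ?_⟩
  · intro Γ Γ₁ h hΓ
    refine (hZ (M + M')).mono h fun γ hγ => ?_
    rcases Multiset.mem_add.1 hγ with hγ | hγ
    · exact (hΓ γ hγ).weaken (Multiset.subset_of_le (Multiset.le_add_right _ _))
    · exact Ent.hyp (Multiset.mem_add.2 (Or.inr hγ))
  · intro Γ ψ h hψ
    refine (hZ (M + M')).cover (h.weaken (Multiset.subset_of_le (Multiset.le_add_right _ _)))
      fun t => ?_
    rw [← Multiset.cons_add]
    exact hψ t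
  · intro Γ h
    exact (hZ (M + M')).bot (h.weaken (Multiset.subset_of_le (Multiset.le_add_right _ _)))

theorem Closed.inter (hX : Closed CT X) (hY : Closed CT Y) : Closed CT (X ∩ Y) := by
  intro M
  refine ⟨?_, ?_, ?_⟩
  · exact fun h hΓ => ⟨(hX M).mono h.1 hΓ, (hY M).mono h.2 hΓ⟩
  · exact fun h hψ => ⟨(hX M).cover h fun t => (hψ t).1, (hY M).cover h fun t => (hψ t).2⟩
  · exact fun h => ⟨(hX M).bot h, (hY M).bot h⟩

theorem closed_forall {ι : Type*} {X : ι → Set (World L P)} (h : ∀ i, Closed CT (X i)) :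
    Closed CT {w | ∀ i, w ∈ X i} := by
  intro M
  refine ⟨?_, ?_, ?_⟩
  · exact fun h' hΓ i => (h i M).mono (h' i) hΓ
  · exact fun h' hψ i => (h i M).cover h' fun t => hψ t i
  · exact fun h' i => (h i M).bot h'

theorem closed_univ : Closed CT (Set.univ : Set (World L P)) :=
  fun _ => ⟨fun _ _ => trivial, fun _ _ => trivial, fun _ => trivial⟩

theorem cl_add_subset (hZ : Closed CT Z) (h : X + Y ⊆ Z) : cl CT X + Y ⊆ Z := by
  rintro _ ⟨x, hx, y, hy, rfl⟩
  exact hx _ (hZ.translate y) fun x' hx' => h (Set.add_mem_add hx' hy)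

theorem sum_cl_subset (hZ : Closed CT Z) (Xs : Multiset (Set (World L P))) (h : Xs.sum ⊆ Z) :
    (Xs.map (cl CT)).sum ⊆ Z := by
  have key : ∀ Y, Xs.sum + Y ⊆ Z → (Xs.map (cl CT)).sum + Y ⊆ Z := by
    clear h
    induction Xs using Multiset.induction with
    | empty => simp
    | cons X Xs ih =>
      intro Y h
      rw [Multiset.map_cons, Multiset.sum_cons, add_assoc]
      refine cl_add_subset hZ ?_
      rw [← add_assoc, add_comm X, add_assoc]
      refine ih _ ?_
      rwa [← add_assoc, add_comm Xs.sum, ← Multiset.sum_cons]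
  have := key 0 (by rwa [add_zero])
  rwa [add_zero] at this

/-- The interpretation of a formula as a closed set of worlds, under an assignment of terms to its
free variables. Quantifiers range over all terms. The modality `!` restricts to the worlds
without user-defined atoms. -/
def interp (CT : ConstraintTheory L) :
    {α : Type} → ILL L P α → (α → L.Term ℕ) → Set (World L P)
  | _, .eq s t, ρ => cl CT {w | w.1 = 0 ∧ Ent CT w.2 (.eq (s.subst ρ) (t.subst ρ))}
  | _, .rel c ts, ρ => cl CT {w | w.1 = 0 ∧ Ent CT w.2 (.rel c fun i => (ts i).subst ρ)}
  | _, .user c ts, ρ =>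
    cl CT {w | ∃ a, w.1 = {a} ∧ UAtom.Eqv CT w.2 a ⟨_, c, fun i => (ts i).subst ρ⟩}
  | _, .one, _ => cl CT 0
  | _, .zero, _ => cl CT ∅
  | _, .top, _ => Set.univ
  | _, .tensor φ ψ, ρ => cl CT (interp CT φ ρ + interp CT ψ ρ)
  | _, .lolli φ ψ, ρ => {w | ∀ x ∈ interp CT φ ρ, w + x ∈ interp CT ψ ρ}
  | _, .with φ ψ, ρ => interp CT φ ρ ∩ interp CT ψ ρ
  | _, .plus φ ψ, ρ => cl CT (interp CT φ ρ ∪ interp CT ψ ρ)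
  | _, .bang φ, ρ => cl CT (interp CT φ ρ ∩ {w | w.1 = 0})
  | _, .all φ, ρ => {w | ∀ t, w ∈ interp CT φ (extendSubst t ρ)}
  | _, .ex φ, ρ => cl CT {w | ∃ t, w ∈ interp CT φ (extendSubst t ρ)}

theorem closed_interp {α : Type} (φ : ILL L P α) (ρ : α → L.Term ℕ) :
    Closed CT (interp CT φ ρ) := by
  induction φ with
  | eq | rel | user | one | zero | tensor | plus | bang | ex => exact closed_cl _ _
  | top => exact closed_univ
  | lolli φ ψ _ ih =>
    have := closed_forall fun x : interp CT φ ρ => (ih ρ).translate x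
    simp only [Subtype.forall] at this
    exact this
  | all φ ih => exact closed_forall fun t => ih _
  | _ φ ψ ih ih' => exact (ih ρ).inter (ih' ρ)

theorem interp_subst {α β : Type} (φ : ILL L P α) (σ : α → L.Term β) (ρ : β → L.Term ℕ) :
    interp CT (φ.subst σ) ρ = interp CT φ fun a => (σ a).subst ρ := by
  induction φ generalizing β with
  | one | zero | top => rfl
  | eq s t => simp only [ILL.subst, interp, term_subst_subst]
  | rel c ts | user c ts => simp only [ILL.subst, interp, term_subst_subst]
  | bang φ h => simp only [ILL.subst, interp, h]
  | all φ h | ex φ h => simp only [ILL.subst, interp, h, liftSubst_extendSubst]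
  | _ φ ψ h₁ h₂ =>
    simp only [ILL.subst, interp, h₁, h₂]

theorem interp_inst (φ : ILL L P (Option ℕ)) (t : L.Term ℕ) (ρ : ℕ → L.Term ℕ) :
    interp CT (φ.inst t) ρ = interp CT φ (extendSubst (t.subst ρ) ρ) := by
  rw [ILL.inst, interp_subst, instSubst_subst]

theorem interp_congr {α : Type} [inst : DecidableEq α] {φ : ILL L P α} {ρ ρ' : α → L.Term ℕ}
    (h : ∀ a ∈ φ.fv, ρ a = ρ' a) : interp CT φ ρ = interp CT φ ρ' := by
  revert inst
  induction φ with
  | one | zero | top =>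
    intro _ h
    rfl
  | eq s t =>
    intro _ h
    simp only [ILL.fv, Finset.mem_union] at h
    simp only [interp]
    rw [term_subst_congr fun a ha => h a (Or.inl ha), term_subst_congr fun a ha => h a (Or.inr ha)]
  | rel c ts | user c ts =>
    intro _ h
    simp only [ILL.fv, Finset.mem_biUnion, Finset.mem_univ, true_and] at h
    have : (fun i => (ts i).subst ρ) = fun i => (ts i).subst ρ' :=
      funext fun i => term_subst_congr fun a ha => h a ⟨i, ha⟩
    simp only [interp, this]
  | bang φ ih =>
    intro _ h
    simp only [interp]
    rw [ih h]
  | all φ ih | ex φ ih =>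
    intro _ h
    simp only [interp]
    have := fun t => ih (extendSubst_congr t h)
    simp only [this]
  | _ φ ψ h₁ h₂ =>
    intro _ h
    simp only [ILL.fv, Finset.mem_union] at h
    simp only [interp]
    rw [h₁ fun a ha => h a (Or.inl ha), h₂ fun a ha => h a (Or.inr ha)]

theorem mem_cl_zero_of_fst {w : World L P} (h : w.1 = 0) : w ∈ cl CT (0 : Set (World L P)) := by
  obtain ⟨M, Γ⟩ := w
  obtain rfl : M = 0 := h
  exact (closed_cl CT 0 0).mono (Γ := 0) (subset_cl CT 0 (Set.mem_zero.2 rfl)) (by simp)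

theorem interp_bang_subset_one (φ : ILL L P ℕ) (ρ : ℕ → L.Term ℕ) :
    interp CT (.bang φ) ρ ⊆ cl CT 0 :=
  cl_subset (closed_cl _ _) fun _ hw => mem_cl_zero_of_fst hw.2

theorem subset_interp_of_one {ρ : ℕ → L.Term ℕ} (φ : ILL L P ℕ) (h : X ⊆ interp CT φ ρ) :
    cl CT 0 + X ⊆ interp CT φ ρ :=
  cl_add_subset (closed_interp φ ρ) (by rwa [zero_add])

/-- Soundness of the phase semantics for the sequent calculus, under all assignments. -/
theorem ILL.Provable.interp_subset {Ax : Set (Sequent L P)}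
    (hAx : ∀ s ∈ Ax, ∀ ρ, (s.1.map fun γ => interp CT γ ρ).sum ⊆ interp CT s.2 ρ)
    {Γ : Multiset (ILL L P ℕ)} {φ : ILL L P ℕ} (h : ILL.Provable Ax Γ φ) (ρ : ℕ → L.Term ℕ) :
    (Γ.map fun γ => interp CT γ ρ).sum ⊆ interp CT φ ρ := by
  have upd : ∀ (ρ : ℕ → L.Term ℕ) {a : ℕ} (t : L.Term ℕ) {ψ : ILL L P ℕ}, a ∉ ψ.fv →
      interp CT ψ (Function.update ρ a t) = interp CT ψ ρ := by
    intro ρ a t ψ ha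
    refine interp_congr fun y hy => ?_
    rw [Function.update_of_ne]
    rintro rfl
    exact ha hy
  have updInst : ∀ (ρ : ℕ → L.Term ℕ) {a : ℕ} (t : L.Term ℕ) {ψ : ILL L P (Option ℕ)},
      a ∉ Finset.eraseNone ψ.fv → interp CT (ψ.inst (Term.var a)) (Function.update ρ a t) =
        interp CT ψ (extendSubst t ρ) := by
    intro ρ a t ψ ha
    rw [interp_inst]
    simp only [Term.subst, Function.update_self]
    refine interp_congr (extendSubst_congr _ fun y hy => ?_)
    rw [Function.update_of_ne]
    rintro rfl
    exact ha hy
  have updΓ : ∀ (ρ : ℕ → L.Term ℕ) {a : ℕ} (t : L.Term ℕ) {Γ : Multiset (ILL L P ℕ)},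
      (∀ γ ∈ Γ, a ∉ γ.fv) → (Γ.map fun γ => interp CT γ (Function.update ρ a t)) = Γ.map fun γ => interp CT γ ρ :=
    fun ρ _ t Γ hΓ => Multiset.map_congr rfl fun γ hγ => upd ρ t (hΓ γ hγ)
  induction h generalizing ρ with
  | proper h => exact hAx _ h ρ
  | identity φ => simp
  | @cut Γ Δ φ ψ _ _ ih₁ ih₂ =>
    rw [Multiset.map_add, Multiset.sum_add]
    refine (Set.add_subset_add_right (ih₁ ρ)).trans ?_
    have := ih₂ ρ
    rwa [Multiset.map_cons, Multiset.sum_cons] at this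
  | @tensorL Γ φ ψ χ _ ih =>
    rw [Multiset.map_cons, Multiset.sum_cons]
    refine cl_add_subset (closed_interp _ _) ?_
    have := ih ρ
    rwa [Multiset.map_cons, Multiset.sum_cons, Multiset.map_cons, Multiset.sum_cons,
      ← add_assoc] at this
  | tensorR _ _ ih₁ ih₂ =>
    rw [Multiset.map_add, Multiset.sum_add]
    exact (Set.add_subset_add (ih₁ ρ) (ih₂ ρ)).trans
      (subset_cl _ _)
  | oneL _ ih =>
    rw [Multiset.map_cons, Multiset.sum_cons]
    exact subset_interp_of_one _ (ih ρ)
  | oneR => exact subset_cl _ _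
  | @lolliL Γ Δ φ ψ χ _ _ ih₁ ih₂ =>
    rw [Multiset.map_cons, Multiset.sum_cons, Multiset.map_add, Multiset.sum_add, ← add_assoc]
    have h₂ := ih₂ ρ
    rw [Multiset.map_cons, Multiset.sum_cons] at h₂
    refine (Set.add_subset_add_right ?_).trans h₂
    rintro _ ⟨f, hf, x, hx, rfl⟩
    exact hf x (ih₁ ρ hx)
  | lolliR _ ih =>
    have := ih ρ
    rw [Multiset.map_cons, Multiset.sum_cons, add_comm] at this
    exact fun w hw x hx => this (Set.add_mem_add hw hx)
  | @bangR Γ φ _ ih =>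
    have h := ih ρ
    rw [Multiset.map_map] at h ⊢
    have split : ((Γ.map fun γ => interp CT γ ρ ∩ {w : World L P | w.1 = 0}).map (cl CT)).sum ⊆
        interp CT φ ρ := by rwa [Multiset.map_map]
    have goal := sum_cl_subset (closed_cl CT (interp CT φ ρ ∩ {w | w.1 = 0}))
      (Γ.map fun γ => interp CT γ ρ ∩ {w : World L P | w.1 = 0}) (by
        have sub : ∀ Xs : Multiset (Set (World L P)), Xs.sum ⊆ (Xs.map (cl CT)).sum := by
          intro Xs
          induction Xs using Multiset.induction with
          | empty => simp
          | cons X Xs ih =>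
            rw [Multiset.map_cons, Multiset.sum_cons, Multiset.sum_cons]
            exact Set.add_subset_add (subset_cl _ _) ih
        have fst : (Γ.map fun γ => interp CT γ ρ ∩ {w : World L P | w.1 = 0}).sum ⊆
            {w : World L P | w.1 = 0} := by
          clear split h ih
          rename_i h₀
          clear h₀
          induction Γ using Multiset.induction with
          | empty => simp
          | cons γ Γ ih =>
            rw [Multiset.map_cons, Multiset.sum_cons]
            rintro _ ⟨x, hx, y, hy, rfl⟩
            have h₁ : x.1 = 0 := hx.2
            have h₂ : y.1 = 0 := ih hy
            simp [h₁, h₂]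
        exact fun w hw => subset_cl _ _ ⟨split (sub _ hw), fst hw⟩)
    rwa [Multiset.map_map] at goal
  | @dereliction Γ φ ψ _ ih =>
    have := ih ρ
    rw [Multiset.map_cons, Multiset.sum_cons] at this ⊢
    exact (Set.add_subset_add_right (cl_subset (closed_interp _ _)
      Set.inter_subset_left)).trans this
  | @contraction Γ φ ψ _ ih =>
    have := ih ρ
    rw [Multiset.map_cons, Multiset.sum_cons, Multiset.map_cons, Multiset.sum_cons] at this
    rw [Multiset.map_cons, Multiset.sum_cons]
    refine cl_add_subset (closed_interp _ _) ?_
    rintro _ ⟨⟨M, Δ⟩, hx, y, hy, rfl⟩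
    -- a world without atoms is entailed by its own double
    have h₁ := this (Set.add_mem_add (subset_cl CT _ hx)
      (Set.add_mem_add (subset_cl CT _ hx) hy))
    obtain ⟨N, Δ'⟩ := y
    obtain rfl : M = 0 := hx.2
    simp only [Prod.mk_add_mk, zero_add] at h₁ ⊢
    refine (closed_interp ψ ρ N).mono h₁ fun γ hγ => Ent.hyp ?_
    simp only [Multiset.mem_add] at hγ ⊢
    tauto
  | weakening _ ih =>
    rw [Multiset.map_cons, Multiset.sum_cons]
    exact (Set.add_subset_add_right (interp_bang_subset_one _ _)).trans
      (subset_interp_of_one _ (ih ρ))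
  | withL₁ _ ih =>
    have := ih ρ
    rw [Multiset.map_cons, Multiset.sum_cons] at this ⊢
    exact (Set.add_subset_add_right Set.inter_subset_left).trans this
  | withL₂ _ ih =>
    have := ih ρ
    rw [Multiset.map_cons, Multiset.sum_cons] at this ⊢
    exact (Set.add_subset_add_right Set.inter_subset_right).trans this
  | withR _ _ ih₁ ih₂ =>
    exact Set.subset_inter (ih₁ ρ) (ih₂ ρ)
  | topR Γ => exact Set.subset_univ _
  | plusL _ _ ih₁ ih₂ =>
    have h₁ := ih₁ ρ
    have h₂ := ih₂ ρ
    rw [Multiset.map_cons, Multiset.sum_cons] at h₁ h₂ ⊢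
    refine cl_add_subset (closed_interp _ _) ?_
    rw [Set.union_add]
    exact Set.union_subset h₁ h₂
  | plusR₁ _ ih =>
    exact (ih ρ).trans (Set.subset_union_left.trans (subset_cl _ _))
  | plusR₂ _ ih =>
    exact (ih ρ).trans (Set.subset_union_right.trans (subset_cl _ _))
  | zeroL φ =>
    rw [Multiset.map_singleton, Multiset.sum_singleton]
    exact cl_subset (closed_interp _ _) (Set.empty_subset _)
  | @allL Γ φ ψ t _ ih =>
    have := ih ρ
    rw [Multiset.map_cons, Multiset.sum_cons, interp_inst] at this
    rw [Multiset.map_cons, Multiset.sum_cons]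
    refine (Set.add_subset_add_right ?_).trans this
    exact fun w (hw : ∀ t, w ∈ interp CT φ (extendSubst t ρ)) => hw _
  | @allR Γ φ a ha haφ _ ih =>
    intro w hw t
    have := ih (Function.update ρ a t)
    rw [updΓ ρ t ha, updInst ρ t haφ] at this
    exact this hw
  | @exL Γ φ ψ a ha haφ haψ _ ih =>
    rw [Multiset.map_cons, Multiset.sum_cons]
    refine cl_add_subset (closed_interp _ _) ?_
    rintro _ ⟨x, ⟨t, hx⟩, y, hy, rfl⟩
    have := ih (Function.update ρ a t)
    rw [Multiset.map_cons, Multiset.sum_cons, updΓ ρ t ha, updInst ρ t haφ, upd ρ t haψ] at this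
    exact this (Set.add_mem_add hx hy)
  | @exR Γ φ t _ ih =>
    have := ih ρ
    rw [interp_inst] at this
    exact this.trans fun w hw => subset_cl _ _ ⟨_, hw⟩

end PhaseSemantics

/-! ### Readings of states in the phase semantics -/

section Completeness

open scoped Pointwise

variable {L : FirstOrder.Language.{u, v}} {P : ℕ → Type w} {CT : ConstraintTheory L}

theorem closed_of_formulas {Φ : Multiset (UAtom L P) → Set (IL L ℕ)}
    (hΦ : ∀ M, ∃ s : Finset ℕ, ∀ φ ∈ Φ M, φ.fv ⊆ s) :
    Closed CT {w : World L P | Ent CT w.2 .bot ∨ ∃ φ ∈ Φ w.1, Ent CT w.2 φ} :=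
  fun M => stable_of_formulas (hΦ M)

theorem interp_exVar (x : ℕ) (φ : ILL L P ℕ) (ρ : ℕ → L.Term ℕ) :
    interp CT (ILL.exVar x φ) ρ = cl CT {w | ∃ t, w ∈ interp CT φ (Function.update ρ x t)} := by
  simp only [ILL.exVar, interp, interp_subst, bindSubst_extendSubst]

theorem interp_exs_subset {xs : Finset ℕ} {φ : ILL L P ℕ} {ρ : ℕ → L.Term ℕ}
    {Z : Set (World L P)} (hZ : Closed CT Z)
    (h : ∀ τ, (∀ y ∉ xs, τ y = ρ y) → interp CT φ τ ⊆ Z) : interp CT (ILL.exs xs φ) ρ ⊆ Z := by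
  have key : ∀ (l : List ℕ) (ρ : ℕ → L.Term ℕ),
      (∀ τ, (∀ y ∉ l, τ y = ρ y) → interp CT φ τ ⊆ Z) →
      interp CT (l.foldr ILL.exVar φ) ρ ⊆ Z := by
    intro l
    induction l with
    | nil => exact fun ρ h => h ρ fun _ _ => rfl
    | cons x l ih =>
      intro ρ h
      rw [List.foldr_cons, interp_exVar]
      refine cl_subset hZ ?_
      rintro w ⟨t, hw⟩
      refine ih _ (fun τ hτ => h τ fun y hy => ?_) hw
      simp only [List.mem_cons, not_or] at hy
      rw [hτ y hy.2, Function.update_of_ne hy.1]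
  exact key _ ρ fun τ hτ => h τ fun y hy => hτ y (by simpa using hy)

theorem subset_interp_exs {xs : Finset ℕ} {φ : ILL L P ℕ} {ρ τ : ℕ → L.Term ℕ}
    (hτ : ∀ y ∉ xs, τ y = ρ y) : interp CT φ τ ⊆ interp CT (ILL.exs xs φ) ρ := by
  have key : ∀ (l : List ℕ) (ρ : ℕ → L.Term ℕ), (∀ y ∉ l, τ y = ρ y) →
      interp CT φ τ ⊆ interp CT (l.foldr ILL.exVar φ) ρ := by
    intro l
    induction l with
    | nil =>
      intro ρ hρ
      rw [funext fun y => hρ y (by simp), List.foldr_nil]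
    | cons x l ih =>
      intro ρ hρ w hw
      rw [List.foldr_cons, interp_exVar]
      refine subset_cl _ _ ⟨τ x, ih _ (fun y hy => ?_) hw⟩
      by_cases hyx : y = x
      · subst hyx
        rw [Function.update_self]
      · rw [Function.update_of_ne hyx]
        exact hρ y (by simp [hyx, hy])
  exact key _ ρ fun y hy => hτ y (by simpa using hy)

/-- The worlds that are inconsistent, or have no atoms and entail `φ`. -/
def builtinWorlds (P : ℕ → Type w) (CT : ConstraintTheory L) (φ : IL L ℕ) : Set (World L P) :=
  {w | Ent CT w.2 .bot ∨ w.1 = 0 ∧ Ent CT w.2 φ}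

theorem closed_builtinWorlds (φ : IL L ℕ) : Closed CT (builtinWorlds P CT φ) := by
  have := closed_of_formulas (CT := CT) (P := P) (Φ := fun M => {ψ | M = 0 ∧ ψ = φ})
    fun M => ⟨φ.fv, by rintro _ ⟨-, rfl⟩; rfl⟩
  convert this using 1
  ext w
  simp only [builtinWorlds, Set.mem_ofPred_eq]
  refine or_congr_right ⟨fun h => ⟨φ, ⟨h.1, rfl⟩, h.2⟩, ?_⟩
  rintro ⟨_, ⟨h, rfl⟩, h'⟩
  exact ⟨h, h'⟩

theorem interp_builtin_subset (B : Builtin L) (ρ : ℕ → L.Term ℕ) :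
    interp CT (B.toILL P) ρ ⊆ builtinWorlds P CT (B.toIL.subst ρ) := by
  induction B with
  | top =>
    refine cl_subset (closed_builtinWorlds _) ?_
    rintro _ rfl
    exact Or.inr ⟨rfl, Ent.top⟩
  | atom b =>
    cases b with
    | bot => exact cl_subset (closed_builtinWorlds _) (Set.empty_subset _)
    | eq s t =>
      exact cl_subset (closed_builtinWorlds _) fun w hw =>
        cl_subset (closed_builtinWorlds _) (fun w hw => Or.inr hw) hw.1
    | rel c ts =>
      exact cl_subset (closed_builtinWorlds _) fun w hw =>
        cl_subset (closed_builtinWorlds _) (fun w hw => Or.inr hw) hw.1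
  | and B B' ih ih' =>
    refine cl_subset (closed_builtinWorlds _) ?_
    rintro _ ⟨⟨M, Γ⟩, hx, ⟨M', Γ'⟩, hy, rfl⟩
    have hl : Γ ⊆ Γ + Γ' := Multiset.subset_of_le (Multiset.le_add_right _ _)
    have hr : Γ' ⊆ Γ + Γ' := Multiset.subset_of_le (Multiset.le_add_left _ _)
    rcases ih hx with h | ⟨h₁, h₂⟩
    · exact Or.inl (Ent.weaken h hl)
    rcases ih' hy with h' | ⟨h₁', h₂'⟩
    · exact Or.inl (Ent.weaken h' hr)
    obtain rfl : M = 0 := h₁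
    obtain rfl : M' = 0 := h₁'
    exact Or.inr ⟨add_zero 0, ent_and.2 ⟨h₂.weaken hl, h₂'.weaken hr⟩⟩

theorem mem_interp_builtin {B : Builtin L} {ρ : ℕ → L.Term ℕ} {Γ : Multiset (IL L ℕ)}
    (h : Ent CT Γ (B.toIL.subst ρ)) : (0, Γ) ∈ interp CT (B.toILL P) ρ := by
  induction B with
  | top => exact mem_cl_zero_of_fst rfl
  | atom b =>
    cases b with
    | bot => exact (closed_cl CT (∅ : Set (World L P)) 0).bot h
    | eq s t => exact subset_cl _ _ ⟨subset_cl _ _ ⟨rfl, h⟩, rfl⟩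
    | rel c ts => exact subset_cl _ _ ⟨subset_cl _ _ ⟨rfl, h⟩, rfl⟩
  | and B B' ih ih' =>
    obtain ⟨h₁, h₂⟩ := ent_and.1 h
    refine (closed_interp ((Builtin.and B B').toILL P) ρ 0).mono (Γ := Γ + Γ) ?_ fun γ hγ =>
      Ent.hyp (by simpa using hγ)
    exact subset_cl CT _ (Set.add_mem_add (ih h₁) (ih' h₂))

theorem interp_sigmaCT {xs xs' : Finset ℕ} {B B' : Builtin L}
    (h : CT.Entails (.imp (.exs xs B.toIL) (.exs xs' B'.toIL))) (ρ : ℕ → L.Term ℕ) :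
    interp CT (ILL.exs xs (B.toILL P)) ρ ⊆ interp CT (ILL.exs xs' (B'.toILL P)) ρ := by
  have h₁ : interp CT (ILL.exs xs (B.toILL P)) ρ ⊆
      builtinWorlds P CT ((IL.exs xs B.toIL).subst ρ) := by
    refine interp_exs_subset (closed_builtinWorlds _) fun τ hτ w hw => ?_
    rcases interp_builtin_subset B τ hw with h' | ⟨h₁, h₂⟩
    · exact Or.inl h'
    · exact Or.inr ⟨h₁, h₂.exs_intro fun y _ hy => hτ y hy⟩
  refine h₁.trans ?_
  rintro ⟨M, Γ⟩ (h' | ⟨h₁, h₂⟩)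
  · exact (closed_interp _ _ _).bot h'
  · obtain rfl : M = 0 := h₁
    refine (closed_interp _ ρ 0).exs_elim (forces_of_entails_imp h ρ h₂) fun τ hτ => ?_
    exact subset_interp_exs hτ (mem_interp_builtin (Ent.hyp (Multiset.mem_cons_self _ _)))

theorem interp_sigmaEq {n : ℕ} (c : P n) (ts : Fin n → L.Term ℕ) (j : Fin n) (r : L.Term ℕ)
    (ρ : ℕ → L.Term ℕ) :
    interp CT (ILL.tensor (.user c ts) (.bang (.eq (ts j) r))) ρ ⊆
      interp CT (ILL.tensor (.user c (Function.update ts j r)) (.bang (.eq (ts j) r))) ρ := by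
  refine cl_subset (closed_interp _ _) (cl_add_subset (closed_interp _ _) ?_)
  rw [add_comm]
  have hb := interp_builtin_subset (P := P) (CT := CT) (.atom (.eq (ts j) r)) ρ
  refine (Set.add_subset_add_right hb).trans ?_
  rintro _ ⟨⟨M, Γ⟩, hx, ⟨M', Γ'⟩, ⟨a, ha, hy⟩, rfl⟩
  rcases hx with h | ⟨h₁, h₂⟩
  · exact (closed_interp (ILL.tensor (.user c (Function.update ts j r)) (.bang (.eq (ts j) r))) ρ
      (M + M')).bot (Γ := Γ + Γ') (Ent.weaken h (Multiset.subset_of_le (Multiset.le_add_right _ _)))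
  obtain rfl : M = 0 := h₁
  obtain rfl : M' = {a} := ha
  have h₃ : Ent CT (Γ + Γ') (.eq ((ts j).subst ρ) (r.subst ρ)) :=
    Ent.weaken h₂ (Multiset.subset_of_le (Multiset.le_add_right _ _))
  have h₄ : UAtom.Eqv CT (Γ + Γ') a ⟨n, c, fun i => (Function.update ts j r i).subst ρ⟩ := by
    refine (hy.mono fun γ hγ => Ent.hyp (by simp [hγ])).trans (.mk _ _ _ fun i => ?_)
    by_cases hij : i = j
    · subst hij
      rwa [Function.update_self]
    · rw [Function.update_of_ne hij]
      exact Ent.eq_refl _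
  have h₅ : (({a}, Γ + Γ') : World L P) ∈ interp CT (.user c (Function.update ts j r)) ρ :=
    subset_cl _ _ ⟨a, rfl, h₄⟩
  have h₆ := mem_interp_builtin (P := P) (B := .atom (.eq (ts j) r)) (ρ := ρ) h₃
  have := subset_cl CT _ (Set.add_mem_add h₅ h₆)
  rw [Prod.mk_add_mk, add_zero] at this
  have goal := (closed_interp (ILL.tensor (.user c (Function.update ts j r))
    (.bang (.eq (ts j) r))) ρ {a}).mono (Γ' := Γ + Γ') this fun γ hγ => Ent.hyp (by simpa using hγ)
  rw [← zero_add ({a} : Multiset (UAtom L P))] at goal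
  exact goal

theorem interp_subset_of_provable {φ ψ : ILL L P ℕ}
    (h : ILL.Provable (sigmaCT P CT ∪ sigmaEq L P) {φ} ψ) (ρ : ℕ → L.Term ℕ) :
    interp CT φ ρ ⊆ interp CT ψ ρ := by
  have := h.interp_subset (CT := CT) (by
    rintro s (⟨xs, B, xs', B', h, rfl⟩ | ⟨n, c, ts, j, r, rfl⟩) ρ
    · simpa using interp_sigmaCT h ρ
    · simpa using interp_sigmaEq c ts j r ρ) ρ
  simpa using this

/-- The conjunction of a list of atoms. -/
def UserC.ofList : List (UAtom L P) → UserC L P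
  | [] => .top
  | a :: as => .and (.atom a.sym a.args) (ofList as)

theorem UserC.mem_vars_ofList {as : List (UAtom L P)} {y : ℕ} :
    y ∈ (ofList as).vars ↔ ∃ a ∈ as, y ∈ a.vars := by
  induction as with
  | nil => simp [ofList, vars]
  | cons a as ih =>
    simp only [ofList, vars, Finset.mem_union, ih, List.mem_cons, exists_eq_or_imp]
    rfl

theorem mem_interp_ofList (as : List (UAtom L P)) :
    ((as : Multiset (UAtom L P)), (0 : Multiset (IL L ℕ))) ∈
      interp CT (UserC.ofList as).toGoal.toILL Term.var := by
  induction as with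
  | nil => exact subset_cl _ _ rfl
  | cons a as ih =>
    have ha : (({a}, 0) : World L P) ∈ interp CT (.user a.sym a.args) Term.var :=
      subset_cl _ _ ⟨a, rfl, by simpa only [term_subst_var] using UAtom.Eqv.refl a⟩
    have := subset_cl CT _ (Set.add_mem_add ha ih)
    rwa [Prod.mk_add_mk, add_zero, Multiset.singleton_add, Multiset.cons_coe] at this

/-- The worlds that are inconsistent, or whose atoms match the list `bs` up to equations entailed by
the context. -/
def matchingWorlds (CT : ConstraintTheory L) (bs : List (UAtom L P)) : Set (World L P) :=
  {w | Ent CT w.2 .bot ∨ ∃ as : List (UAtom L P), w.1 = as ∧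
    List.Forall₂ (UAtom.Eqv CT w.2) as bs}

theorem exists_vars_bound (M : Multiset (UAtom L P)) (bs : List (UAtom L P)) :
    ∃ s : Finset ℕ, (∀ a ∈ M, a.vars ⊆ s) ∧ ∀ b ∈ bs, b.vars ⊆ s := by
  classical
  refine ⟨M.toFinset.biUnion UAtom.vars ∪ bs.toFinset.biUnion UAtom.vars, ?_, ?_⟩
  · exact fun a ha => (Finset.subset_biUnion_of_mem UAtom.vars (Multiset.mem_toFinset.2 ha)).trans
      Finset.subset_union_left
  · exact fun b hb => (Finset.subset_biUnion_of_mem UAtom.vars (List.mem_toFinset.2 hb)).trans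
      Finset.subset_union_right

theorem closed_matchingWorlds (bs : List (UAtom L P)) : Closed CT (matchingWorlds CT bs) := by
  let Φ : Multiset (UAtom L P) → Set (IL L ℕ) :=
    fun M => {φ | ∃ as : List (UAtom L P), M = as ∧ φ = (UAtom.eqsList as bs).toIL}
  have hΦ : ∀ M, ∃ s : Finset ℕ, ∀ φ ∈ Φ M, φ.fv ⊆ s := by
    intro M
    obtain ⟨s, hs, hs'⟩ := exists_vars_bound M bs
    refine ⟨s, ?_⟩
    rintro _ ⟨as, rfl, rfl⟩
    rw [Builtin.fv_toIL]
    exact UAtom.vars_eqsList hs hs'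
  have := closed_of_formulas (CT := CT) hΦ
  convert this using 1
  ext ⟨M, Γ⟩
  have key : ∀ as, Ent CT Γ (UAtom.eqsList as bs).toIL ↔ Ent CT Γ .bot ∨
      List.Forall₂ (UAtom.Eqv CT Γ) as bs := by
    intro as
    have := UAtom.ent_eqsList (CT := CT) (Γ := Γ) (as := as) (bs := bs) (τ := Term.var)
    simpa only [IL.subst_var, UAtom.subst_var] using this
  simp only [matchingWorlds, Set.mem_ofPred_eq]
  constructor
  · rintro (h | ⟨as, h, h'⟩)
    · exact Or.inl h
    · exact Or.inr ⟨_, ⟨as, h, rfl⟩, (key as).2 (Or.inr h')⟩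
  · rintro (h | ⟨_, ⟨as, h, rfl⟩, h'⟩)
    · exact Or.inl h
    · exact ((key as).1 h').imp id fun h' => ⟨as, h, h'⟩

theorem interp_ofList_subset (bs : List (UAtom L P)) (τ : ℕ → L.Term ℕ) :
    interp CT (UserC.ofList bs).toGoal.toILL τ ⊆ matchingWorlds CT (bs.map (UAtom.subst τ)) := by
  induction bs with
  | nil =>
    refine cl_subset (closed_matchingWorlds _) ?_
    rintro _ rfl
    exact Or.inr ⟨[], rfl, .nil⟩
  | cons b bs ih =>
    refine cl_subset (closed_matchingWorlds _) (cl_add_subset (closed_matchingWorlds _) ?_)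
    rintro _ ⟨⟨M, Γ⟩, ⟨a, ha, hab⟩, ⟨M', Γ'⟩, hy, rfl⟩
    obtain rfl : M = {a} := ha
    rcases ih hy with h | ⟨as, has, h⟩
    · exact Or.inl (Ent.weaken h (Multiset.subset_of_le (Multiset.le_add_left _ _)))
    · obtain rfl : M' = as := has
      refine Or.inr ⟨a :: as, by simp, .cons ?_ ?_⟩
      · exact hab.mono fun γ hγ => Ent.hyp (by simp [show γ ∈ Γ from hγ])
      · exact h.imp fun a b hab => hab.mono fun γ hγ => Ent.hyp (by simp [show γ ∈ Γ' from hγ])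

/-- A derivation of `Sᴸ ⊢ Tᴸ` yields a matching of the user-defined atoms of `S` with those of `T`
under which the built-in constraint of `S` entails that of `T`. -/
theorem exists_matching_of_provable {as bs : List (UAtom L P)} {B B' : Builtin L}
    {V V' : Finset ℕ}
    (hl : ∀ a ∈ as, Disjoint a.vars (State.normal (.ofList bs) B' V').localVars)
    (h : ILL.Provable (sigmaCT P CT ∪ sigmaEq L P) {(State.normal (.ofList as) B V).toILL}
      (State.normal (.ofList bs) B' V').toILL) :
    Ent CT {B.toIL} .bot ∨ ∃ as' : List (UAtom L P), as'.Perm as ∧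
      Ent CT {B.toIL} (IL.exs (State.normal (.ofList bs) B' V').localVars
        (Builtin.and (UAtom.eqsList as' bs) B').toIL) := by
  set l := (State.normal (.ofList bs) B' V').localVars
  have hS : ((as : Multiset (UAtom L P)), {B.toIL}) ∈
      interp CT (State.normal (.ofList as) B V).toILL Term.var := by
    refine subset_interp_exs (fun _ _ => rfl) ?_
    have := subset_cl CT _ (Set.add_mem_add (mem_interp_ofList (CT := CT) as)
      (mem_interp_builtin (P := P) (B := B) (ρ := Term.var) (CT := CT) (Γ := {B.toIL})
        (by rw [IL.subst_var]; exact Ent.hyp (by simp))))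
    rwa [Prod.mk_add_mk, add_zero, zero_add] at this
  let Φ : Multiset (UAtom L P) → Set (IL L ℕ) := fun M => {φ | ∃ as' : List (UAtom L P),
    M = as' ∧ φ = IL.exs l (Builtin.and (UAtom.eqsList as' bs) B').toIL}
  have hΦ : ∀ M, ∃ s : Finset ℕ, ∀ φ ∈ Φ M, φ.fv ⊆ s := by
    intro M
    obtain ⟨s, hs, hs'⟩ := exists_vars_bound M bs
    refine ⟨s ∪ B'.vars, ?_⟩
    rintro _ ⟨as, rfl, rfl⟩ y hy
    have := (IL.mem_fv_exs hy).1
    rw [Builtin.fv_toIL] at this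
    exact Finset.union_subset_union (UAtom.vars_eqsList hs hs') subset_rfl this
  -- only multisets of atoms that avoid the bound variables `l` are constrained
  let Z : Set (World L P) := {w | (∀ a ∈ w.1, Disjoint a.vars l) →
    Ent CT w.2 .bot ∨ ∃ φ ∈ Φ w.1, Ent CT w.2 φ}
  have hZ : Closed CT Z := by
    intro M
    by_cases hM : ∀ a ∈ M, Disjoint a.vars l
    · have := closed_of_formulas (CT := CT) hΦ M
      convert this using 1
      ext Γ
      exact ⟨fun h => h hM, fun h _ => h⟩
    · exact ⟨fun _ _ h => absurd h hM, fun _ _ h => absurd h hM, fun _ h => absurd h hM⟩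
  have hT : interp CT (State.normal (.ofList bs) B' V').toILL Term.var ⊆ Z := by
    refine interp_exs_subset hZ fun τ hτ => cl_subset hZ ?_
    rintro _ ⟨⟨M, Γ⟩, hx, ⟨M', Γ'⟩, hy, rfl⟩ hd
    have hl : Γ ⊆ Γ + Γ' := Multiset.subset_of_le (Multiset.le_add_right _ _)
    have hr : Γ' ⊆ Γ + Γ' := Multiset.subset_of_le (Multiset.le_add_left _ _)
    rcases interp_ofList_subset bs τ hx with h | ⟨as', hM, h⟩
    · exact Or.inl (Ent.weaken h hl)
    rcases interp_builtin_subset B' τ hy with h' | ⟨hM', h'⟩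
    · exact Or.inl (Ent.weaken h' hr)
    obtain rfl : M' = 0 := hM'
    obtain rfl : M = as' := hM
    simp only [Prod.mk_add_mk, add_zero] at hd ⊢
    have hsub : ∀ a ∈ as', a.subst τ = a := by
      intro a ha
      rw [UAtom.subst_congr (τ := Term.var), UAtom.subst_var]
      exact fun y hy => hτ y (Finset.disjoint_left.1 (hd a (by simpa using ha)) hy)
    refine Or.inr ⟨_, ⟨as', rfl, rfl⟩, ?_⟩
    have : Ent CT (Γ + Γ') ((IL.exs l (Builtin.and (UAtom.eqsList as' bs) B').toIL).subst
        Term.var) := by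
      refine Ent.exs_intro (τ' := τ) ?_ fun y _ hy => hτ y hy
      refine ent_and.2 ⟨UAtom.ent_eqsList.2 (Or.inr ?_), Ent.weaken h' hr⟩
      rw [List.forall₂_map_right_iff] at h
      rw [List.forall₂_iff_get] at h ⊢
      refine ⟨h.1, fun i h₁ h₂ => ?_⟩
      rw [hsub _ (List.get_mem _ _)]
      exact (h.2 i h₁ h₂).mono fun γ hγ => Ent.hyp (hl hγ)
    rwa [IL.subst_var] at this
  rcases hT (interp_subset_of_provable h _ hS) (by simpa using hl) with h | ⟨_, ⟨as', h₁, rfl⟩, h₂⟩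
  · exact Or.inl h
  · exact Or.inr ⟨as', (Multiset.coe_eq_coe.1 h₁).symm, h₂⟩

end Completeness

/-! ### Laws of state equivalence -/

section StateLaws

variable {L : FirstOrder.Language.{u, v}} {P : ℕ → Type w} {CT : ConstraintTheory L}

theorem GoalEquiv.and_top (G : Goal L P) : GoalEquiv (.and G .top) G :=
  (GoalEquiv.comm _ _).trans (GoalEquiv.top_and G)

theorem GoalEquiv.left_comm (G₁ G₂ G₃ : Goal L P) :
    GoalEquiv (.and G₁ (.and G₂ G₃)) (.and G₂ (.and G₁ G₃)) :=
  (GoalEquiv.assoc _ _ _).symm.trans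
    (((GoalEquiv.comm G₁ G₂).congr (.refl G₃)).trans (.assoc _ _ _))

theorem GoalEquiv.and_and_and_comm (G₁ G₂ G₃ G₄ : Goal L P) :
    GoalEquiv (.and (.and G₁ G₂) (.and G₃ G₄)) (.and (.and G₁ G₃) (.and G₂ G₄)) :=
  (GoalEquiv.assoc _ _ _).trans
    (((GoalEquiv.refl G₁).congr (.left_comm G₂ G₃ G₄)).trans (GoalEquiv.assoc _ _ _).symm)

theorem goalEquiv_ofList_append (as bs : List (UAtom L P)) :
    GoalEquiv (UserC.ofList (as ++ bs)).toGoal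
      (.and (UserC.ofList as).toGoal (UserC.ofList bs).toGoal) := by
  induction as with
  | nil => exact (GoalEquiv.top_and _).symm
  | cons a as ih => exact ((GoalEquiv.refl _).congr ih).trans (GoalEquiv.assoc _ _ _).symm

theorem goalEquiv_ofList_of_perm {as bs : List (UAtom L P)} (h : as.Perm bs) :
    GoalEquiv (UserC.ofList as).toGoal (UserC.ofList bs).toGoal := by
  induction h with
  | nil => exact .refl _
  | cons a _ ih => exact (GoalEquiv.refl _).congr ih
  | swap a b l => exact GoalEquiv.left_comm _ _ _
  | trans _ _ ih ih' => exact ih.trans ih'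

/-- Every goal is equivalent to a conjunction of user-defined atoms and a built-in constraint. -/
theorem Goal.exists_normal (G : Goal L P) : ∃ (as : List (UAtom L P)) (B : Builtin L),
    GoalEquiv G (.and (UserC.ofList as).toGoal (B.toGoal P)) := by
  induction G with
  | top => exact ⟨[], .top, (GoalEquiv.top_and _).symm⟩
  | user c ts =>
    exact ⟨[⟨_, c, ts⟩], .top, ((GoalEquiv.and_top _).trans (GoalEquiv.and_top _)).symm⟩
  | builtin b => exact ⟨[], .atom b, (GoalEquiv.top_and _).symm⟩
  | and G G' ih ih' =>
    obtain ⟨as, B, h⟩ := ih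
    obtain ⟨bs, B', h'⟩ := ih'
    refine ⟨as ++ bs, .and B B', (h.congr h').trans ((GoalEquiv.and_and_and_comm _ _ _ _).trans ?_)⟩
    exact (goalEquiv_ofList_append as bs).symm.congr (.refl _)

theorem Ent.forces {φ ψ : IL L ℕ} {Γ : Multiset (IL L ℕ)} (h : Ent CT {φ} ψ) (τ : ℕ → L.Term ℕ)
    (hφ : Ent CT Γ (φ.subst τ)) : Ent CT Γ (ψ.subst τ) :=
  (h.subst τ).trans (by simpa using hφ)

theorem ent_of_forces {φ ψ : IL L ℕ} (h : ∀ (Γ : Multiset (IL L ℕ)) (τ : ℕ → L.Term ℕ),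
    Ent CT Γ (φ.subst τ) → Ent CT Γ (ψ.subst τ)) : Ent CT {φ} ψ := by
  have := h {φ} Term.var (by rw [IL.subst_var]; exact Ent.hyp (by simp))
  rwa [IL.subst_var] at this

theorem Builtin.subst_congr {B : Builtin L} {σ τ : ℕ → L.Term ℕ} (h : ∀ y ∈ B.vars, σ y = τ y) :
    B.toIL.subst σ = B.toIL.subst τ :=
  IL.subst_congr fun y hy => h y (by rwa [B.fv_toIL] at hy)

theorem term_singleSubst_of_notMem {x : ℕ} {t s : L.Term ℕ} (h : x ∉ s.varFinset) :
    s.subst (singleSubst x t) = s := by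
  rw [term_subst_congr (τ := Term.var), term_subst_var]
  intro y hy
  rw [singleSubst, if_neg]
  rintro rfl
  exact h hy

theorem userC_singleSubst_of_notMem {x : ℕ} {t : L.Term ℕ} {U : UserC L P} (h : x ∉ U.vars) :
    U.subst x t = U := by
  induction U with
  | top => rfl
  | atom c ts =>
    simp only [UserC.vars, Finset.mem_biUnion, Finset.mem_univ, true_and, not_exists] at h
    simp only [UserC.subst, term_singleSubst_of_notMem (h _)]
  | and U U' ih ih' =>
    simp only [UserC.vars, Finset.mem_union, not_or] at h
    simp only [UserC.subst, ih h.1, ih' h.2]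

namespace StateEquiv

/-- The law for `CT` with its premise in terms of contexts and assignments. -/
theorem theory_of_forces {U : UserC L P} {B B' : Builtin L} {V : Finset ℕ}
    (h : ∀ (Γ : Multiset (IL L ℕ)) (τ : ℕ → L.Term ℕ), Ent CT Γ (B.toIL.subst τ) →
      Ent CT Γ ((IL.exs (B'.vars \ (V ∪ U.vars)) B'.toIL).subst τ))
    (h' : ∀ (Γ : Multiset (IL L ℕ)) (τ : ℕ → L.Term ℕ), Ent CT Γ (B'.toIL.subst τ) →
      Ent CT Γ ((IL.exs (B.vars \ (V ∪ U.vars)) B.toIL).subst τ)) :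
    StateEquiv CT (.normal U B V) (.normal U B' V) := by
  have key : ∀ {B B' : Builtin L}, (∀ (Γ : Multiset (IL L ℕ)) (τ : ℕ → L.Term ℕ),
      Ent CT Γ (B.toIL.subst τ) →
      Ent CT Γ ((IL.exs (B'.vars \ (V ∪ U.vars)) B'.toIL).subst τ)) →
      ∀ (Γ : Multiset (IL L ℕ)) (τ : ℕ → L.Term ℕ),
      Ent CT Γ ((IL.exs (B.vars \ (V ∪ U.vars)) B.toIL).subst τ) →
      Ent CT Γ ((IL.exs (B'.vars \ (V ∪ U.vars)) B'.toIL).subst τ) := by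
    intro B B' h Γ τ hB
    refine (stable_ent _).exs_elim hB fun τ' hτ' => ?_
    have hcongr : (IL.exs (B'.vars \ (V ∪ U.vars)) B'.toIL).subst τ' =
        (IL.exs (B'.vars \ (V ∪ U.vars)) B'.toIL).subst τ := by
      refine IL.subst_congr fun y hy => ?_
      obtain ⟨h₁, h₂⟩ := IL.mem_fv_exs hy
      rw [B'.fv_toIL] at h₁
      exact hτ' y fun h₃ => h₂ (Finset.mem_sdiff.2 ⟨h₁, (Finset.mem_sdiff.1 h₃).2⟩)
    have := h _ τ' (Ent.hyp (Multiset.mem_cons_self _ Γ))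
    rw [hcongr] at this
    exact this
  refine .theory U B B' V (entails_iff_of_forces fun Γ τ => ?_)
  rw [strictlyLocal_eq, strictlyLocal_eq]
  exact ⟨key h Γ τ, key h' Γ τ⟩

theorem of_inconsistent {B B' : Builtin L} (U U' : UserC L P) (V V' : Finset ℕ)
    (h : Ent CT {B.toIL} .bot) (h' : Ent CT {B'.toIL} .bot) :
    StateEquiv CT (.normal U B V) (.normal U' B' V') := by
  have key : ∀ {B : Builtin L} (U : UserC L P) (V : Finset ℕ), Ent CT {B.toIL} .bot →
      StateEquiv CT (.normal U B V) (.normal U (.atom .bot) V) := fun U V h =>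
    theory_of_forces (fun Γ τ hB => Ent.of_bot (h.forces τ hB) _) fun Γ τ hB => Ent.of_bot hB _
  exact (key U V h).trans ((StateEquiv.failed _ _ V V').trans (key U' V' h').symm)

theorem globals_congr {G : Goal L P} {V V' : Finset ℕ} (h : ∀ x ∈ G.vars, x ∈ V ↔ x ∈ V') :
    StateEquiv CT ⟨G, V⟩ ⟨G, V'⟩ := by
  have add : ∀ V W : Finset ℕ, (∀ x ∈ W, x ∉ G.vars) → StateEquiv CT ⟨G, W ∪ V⟩ ⟨G, V⟩ := by
    intro V W
    induction W using Finset.induction with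
    | empty =>
      intro _
      rw [Finset.empty_union]
      exact .refl _
    | insert x W _ ih =>
      intro hW
      rw [Finset.insert_union, Finset.insert_eq]
      exact (StateEquiv.global G x _ (hW x (Finset.mem_insert_self _ _))).trans
        (ih fun y hy => hW y (Finset.mem_insert_of_mem hy))
  have h₁ := add V (V' \ V) fun x hx hG =>
    (Finset.mem_sdiff.1 hx).2 ((h x hG).2 (Finset.mem_sdiff.1 hx).1)
  have h₂ := add V' (V \ V') fun x hx hG =>
    (Finset.mem_sdiff.1 hx).2 ((h x hG).1 (Finset.mem_sdiff.1 hx).1)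
  rw [Finset.sdiff_union_self_eq_union] at h₁ h₂
  rw [Finset.union_comm] at h₂
  exact h₁.symm.trans h₂

/-- Terms that the built-in constraint makes equal may be exchanged in the user-defined
constraint: the fresh variable `x` is equated with either of them. -/
theorem subst_eq {U : UserC L P} {x : ℕ} {t r : L.Term ℕ} {B : Builtin L} {V : Finset ℕ}
    (ht : x ∉ t.varFinset) (hr : x ∉ r.varFinset) (hB : x ∉ B.vars) (hV : x ∉ V)
    (h : Ent CT {B.toIL} (.eq t r)) :
    StateEquiv CT (.normal (U.subst x t) B V) (.normal (U.subst x r) B V) := by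
  have intro_eq : ∀ s : L.Term ℕ, x ∉ s.varFinset →
      StateEquiv CT (.normal (U.subst x s) B V) (.normal U (.and (.atom (.eq (Term.var x) s)) B) V) := by
    intro s hs
    refine StateEquiv.trans (theory_of_forces (fun Γ τ hΓ => ?_) fun Γ τ hΓ => ?_)
      (StateEquiv.subst U x s B V).symm
    · have hupd : B.toIL.subst (Function.update τ x (s.subst τ)) = B.toIL.subst τ :=
        Builtin.subst_congr fun y hy => Function.update_of_ne (by rintro rfl; exact hB hy) _ _
      have hupd' : s.subst (Function.update τ x (s.subst τ)) = s.subst τ :=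
        term_subst_congr fun y hy => Function.update_of_ne (by rintro rfl; exact hs hy) _ _
      refine Ent.exs_intro (τ' := Function.update τ x (s.subst τ)) ?_ fun y hy hy' => ?_
      · refine ent_and.2 ⟨?_, by rwa [hupd]⟩
        simp only [Builtin.toIL, BAtom.toIL, IL.subst, Term.subst, Function.update_self, hupd']
        exact Ent.eq_refl _
      · refine Function.update_of_ne ?_ _ _
        rintro rfl
        refine hy' (Finset.mem_sdiff.2 ⟨by rwa [Builtin.fv_toIL] at hy, ?_⟩)
        rw [Finset.mem_union, mem_vars_userC_subst]
        tauto
    · exact Ent.exs_intro (ent_and.1 hΓ).2 fun _ _ _ => rfl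
  refine (intro_eq t ht).trans (StateEquiv.trans ?_ (intro_eq r hr).symm)
  refine theory_of_forces (fun Γ τ hΓ => ?_) fun Γ τ hΓ => ?_
  · refine Ent.exs_intro (τ' := τ) ?_ fun _ _ _ => rfl
    obtain ⟨h₁, h₂⟩ := ent_and.1 hΓ
    exact ent_and.2 ⟨Ent.eq_trans h₁ (h.forces τ h₂), h₂⟩
  · refine Ent.exs_intro (τ' := τ) ?_ fun _ _ _ => rfl
    obtain ⟨h₁, h₂⟩ := ent_and.1 hΓ
    exact ent_and.2 ⟨Ent.eq_trans h₁ (Ent.eq_symm (h.forces τ h₂)), h₂⟩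

theorem replace_atom {n : ℕ} (c : P n) {ts ss : Fin n → L.Term ℕ} (K : UserC L P) {D : Builtin L}
    (V : Finset ℕ) (h : ∀ i, Ent CT {D.toIL} (.eq (ts i) (ss i))) :
    StateEquiv CT (.normal (.and (.atom c ts) K) D V) (.normal (.and (.atom c ss) K) D V) := by
  have key : ∀ J : Finset (Fin n), StateEquiv CT (.normal (.and (.atom c ts) K) D V)
      (.normal (.and (.atom c (J.piecewise ss ts)) K) D V) := by
    intro J
    induction J using Finset.induction with
    | empty =>
      rw [Finset.piecewise_empty]
      exact .refl _
    | insert j J hj ih =>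
      refine ih.trans ?_
      rw [Finset.piecewise_insert]
      set rs := J.piecewise ss ts with hrs
      have hrj : rs j = ts j := by rw [hrs, Finset.piecewise_eq_of_notMem _ _ _ hj]
      obtain ⟨x, hx⟩ := Infinite.exists_notMem_finset
        ((UserC.atom c rs : UserC L P).vars ∪ (ss j).varFinset ∪ K.vars ∪ D.vars ∪ V)
      simp only [Finset.mem_union, not_or] at hx
      obtain ⟨⟨⟨⟨hxr, hxs⟩, hxK⟩, hxD⟩, hxV⟩ := hx
      simp only [UserC.vars, Finset.mem_biUnion, Finset.mem_univ, true_and, not_exists] at hxr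
      have sub : ∀ t : L.Term ℕ, (UserC.and (.atom c (Function.update rs j (Term.var x))) K).subst
          x t = .and (.atom c (Function.update rs j t)) K := by
        intro t
        simp only [UserC.subst, userC_singleSubst_of_notMem hxK]
        congr 2
        funext i
        by_cases hij : i = j
        · subst hij
          simp [Term.subst, singleSubst]
        · rw [Function.update_of_ne hij, Function.update_of_ne hij,
            term_singleSubst_of_notMem (hxr i)]
      have := subst_eq (CT := CT) (U := .and (.atom c (Function.update rs j (Term.var x))) K)
        (hxr j) hxs hxD hxV (by rw [hrj]; exact h j)
      rwa [sub, sub, Function.update_eq_self] at this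
  have := key Finset.univ
  rwa [Finset.piecewise_univ] at this

theorem replace_atoms {as bs : List (UAtom L P)} {D : Builtin L} (V : Finset ℕ)
    (h : List.Forall₂ (UAtom.Eqv CT {D.toIL}) as bs) :
    StateEquiv CT (.normal (.ofList as) D V) (.normal (.ofList bs) D V) := by
  have key : ∀ K : UserC L P, StateEquiv CT (.normal (.and K (.ofList as)) D V)
      (.normal (.and K (.ofList bs)) D V) := by
    induction h with
    | nil => exact fun _ => .refl _
    | @cons a b as bs hab _ ih =>
      intro K
      obtain ⟨c, ts, ss, h⟩ := hab
      have h₁ := ih (.and (.atom c ss) K)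
      have h₂ := replace_atom c (.and K (.ofList as)) V h
      have goal : ∀ (ts) (as : List (UAtom L P)), StateEquiv CT
          (.normal (.and K (.ofList (⟨_, c, ts⟩ :: as))) D V)
          (.normal (.and (.atom c ts) (.and K (.ofList as))) D V) := fun ts as =>
        .goal V ((GoalEquiv.left_comm _ _ _).congr (.refl _))
      have goal' : ∀ (as : List (UAtom L P)), StateEquiv CT
          (.normal (.and (.and (.atom c ss) K) (.ofList as)) D V)
          (.normal (.and (.atom c ss) (.and K (.ofList as))) D V) := fun as =>
        .goal V ((GoalEquiv.assoc _ _ _).congr (.refl _))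
      exact (goal ts as).trans (h₂.trans ((goal' as).symm.trans (h₁.trans
        ((goal' bs).trans (goal ss bs).symm))))
  have goal : ∀ as : List (UAtom L P), StateEquiv CT
      (.normal (.and .top (.ofList as)) D V) (.normal (.ofList as) D V) := fun as =>
    .goal V ((GoalEquiv.top_and _).congr (.refl _))
  exact (goal as).symm.trans ((key .top).trans (goal bs))

/-- A built-in constraint `B` may be strengthened by a consequence `∃ xs. C` of it, with fresh
bound variables `xs`. -/
theorem strengthen {U : UserC L P} {B C D : Builtin L} {V xs : Finset ℕ}
    (h : Ent CT {B.toIL} (IL.exs xs C.toIL)) (hxs : ∀ y ∈ xs, y ∉ V ∧ y ∉ U.vars ∧ y ∉ B.vars)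
    (hD : ∀ (Γ : Multiset (IL L ℕ)) (τ : ℕ → L.Term ℕ), Ent CT Γ (B.toIL.subst τ) →
      Ent CT Γ (C.toIL.subst τ) → Ent CT Γ (D.toIL.subst τ))
    (hB : ∀ (Γ : Multiset (IL L ℕ)) (τ : ℕ → L.Term ℕ), Ent CT Γ (D.toIL.subst τ) →
      Ent CT Γ (B.toIL.subst τ)) :
    StateEquiv CT (.normal U B V) (.normal U D V) := by
  refine theory_of_forces (fun Γ τ hΓ => ?_) fun Γ τ hΓ =>
    Ent.exs_intro (hB Γ τ hΓ) fun _ _ _ => rfl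
  refine (stable_ent _).exs_elim (h.forces τ hΓ) fun τ' hτ' => ?_
  refine Ent.exs_intro (hD _ τ' ?_ (Ent.hyp (Multiset.mem_cons_self _ _))) fun y hy hy' => ?_
  · rw [Builtin.subst_congr (τ := τ) fun y hy => hτ' y fun h => (hxs y h).2.2 hy]
    exact hΓ.weaken (Multiset.subset_cons _ _)
  · refine hτ' y fun h => hy' (Finset.mem_sdiff.2 ⟨by rwa [D.fv_toIL] at hy, ?_⟩)
    rw [Finset.mem_union]
    exact fun h' => h'.elim (hxs y h).1 (hxs y h).2.1

/-- Two states with the same global and disjoint local variables are equivalent if the built-in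
constraint of either entails that of the other, under one common matching of the atoms. -/
theorem of_matching {as bs : List (UAtom L P)} {B B' : Builtin L} {V : Finset ℕ}
    (hd : Disjoint (State.normal (.ofList as) B V).localVars
      (State.normal (.ofList bs) B' V).localVars)
    (h : Ent CT {B.toIL} (IL.exs (State.normal (.ofList bs) B' V).localVars
      (Builtin.and (UAtom.eqsList as bs) B').toIL))
    (h' : Ent CT {B'.toIL} (IL.exs (State.normal (.ofList as) B V).localVars
      (Builtin.and (UAtom.eqsList as bs) B).toIL)) :
    StateEquiv CT (.normal (.ofList as) B V) (.normal (.ofList bs) B' V) := by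
  simp only [State.localVars_normal] at hd h h'
  have hd' := Finset.disjoint_left.1 hd
  set E := UAtom.eqsList as bs with hE
  set D := Builtin.and E (.and B B') with hD
  have h₁ : StateEquiv CT (.normal (.ofList as) B V) (.normal (.ofList as) D V) := by
    refine strengthen h (fun y hy => ?_) (fun Γ τ h₁ h₂ => ?_) fun Γ τ h => ?_
    · simp only [Finset.mem_sdiff, Finset.mem_union] at hd' hy
      grind
    · obtain ⟨h₃, h₄⟩ := ent_and.1 h₂
      exact ent_and.2 ⟨h₃, ent_and.2 ⟨h₁, h₄⟩⟩
    · exact (ent_and.1 (ent_and.1 h).2).1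
  have h₂ : StateEquiv CT (.normal (.ofList bs) B' V) (.normal (.ofList bs) D V) := by
    refine strengthen h' (fun y hy => ?_) (fun Γ τ h₁ h₂ => ?_) fun Γ τ h => ?_
    · simp only [Finset.mem_sdiff, Finset.mem_union] at hd' hy
      grind
    · obtain ⟨h₃, h₄⟩ := ent_and.1 h₂
      exact ent_and.2 ⟨h₃, ent_and.2 ⟨h₄, h₁⟩⟩
    · exact (ent_and.1 (ent_and.1 h).2).2
  refine h₁.trans (StateEquiv.trans ?_ h₂.symm)
  have hent : Ent CT {D.toIL} (E.toIL.subst Term.var) := by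
    rw [IL.subst_var]
    exact (ent_and.1 (Ent.hyp (Multiset.mem_singleton_self D.toIL))).1
  rcases UAtom.ent_eqsList.1 hent with hbot | hmatch
  · exact of_inconsistent _ _ _ _ hbot hbot
  · refine replace_atoms V ?_
    simpa only [UAtom.subst_var] using hmatch

end StateEquiv

/-- Simultaneous substitution in a built-in constraint. -/
def Builtin.subst (σ : ℕ → L.Term ℕ) : Builtin L → Builtin L
  | .top => .top
  | .atom .bot => .atom .bot
  | .atom (.eq s t) => .atom (.eq (s.subst σ) (t.subst σ))
  | .atom (.rel c ts) => .atom (.rel c fun i => (ts i).subst σ)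
  | .and B B' => .and (B.subst σ) (B'.subst σ)

theorem Builtin.toIL_subst (B : Builtin L) (σ : ℕ → L.Term ℕ) :
    (B.subst σ).toIL = B.toIL.subst σ := by
  induction B with
  | top => rfl
  | atom b => cases b <;> rfl
  | and B B' ih ih' => simp only [Builtin.subst, toIL, IL.subst, ih, ih']

theorem Builtin.mem_vars_subst {B : Builtin L} {σ : ℕ → L.Term ℕ} {z : ℕ}
    (h : z ∈ (B.subst σ).vars) : ∃ y ∈ B.vars, z ∈ (σ y).varFinset := by
  rw [← Builtin.fv_toIL, Builtin.toIL_subst] at h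
  obtain ⟨y, hy, hz⟩ := IL.exists_mem_fv_of_mem_fv_subst h
  exact ⟨y, by rwa [B.fv_toIL] at hy, hz⟩

theorem UAtom.mem_vars_subst {a : UAtom L P} {σ : ℕ → L.Term ℕ} {z : ℕ}
    (h : z ∈ (a.subst σ).vars) : ∃ y ∈ a.vars, z ∈ (σ y).varFinset := by
  obtain ⟨i, -, hi⟩ := Finset.mem_biUnion.1 h
  obtain ⟨y, hy, hz⟩ := mem_varFinset_subst.1 hi
  exact ⟨y, Finset.mem_biUnion.2 ⟨i, Finset.mem_univ _, hy⟩, hz⟩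

/-- The local variables of a state can be renamed away from a finite set. -/
theorem StateEquiv.exists_rename (CT : ConstraintTheory L) (as : List (UAtom L P)) (B : Builtin L)
    (V F : Finset ℕ) : ∃ (bs : List (UAtom L P)) (B' : Builtin L),
      StateEquiv CT (.normal (.ofList as) B V) (.normal (.ofList bs) B' V) ∧
      Disjoint F (State.normal (.ofList bs) B' V).localVars := by
  classical
  set l := (State.normal (.ofList as) B V).localVars with hl
  obtain ⟨N, hN⟩ : ∃ N, ∀ y ∈ F ∪ V ∪ ((UserC.ofList as).vars ∪ B.vars), y < N :=
    ⟨(F ∪ V ∪ ((UserC.ofList as).vars ∪ B.vars)).sup id + 1,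
      fun y hy => Nat.lt_succ_of_le (Finset.le_sup (f := id) hy)⟩
  simp only [Finset.mem_union] at hN
  let σ : ℕ → L.Term ℕ := fun y => if y ∈ l then Term.var (y + N) else Term.var y
  let τ : ℕ → L.Term ℕ := fun y => if N ≤ y then Term.var (y - N) else Term.var y
  have hlN : ∀ y ∈ l, y < N := by
    intro y hy
    rw [hl, State.localVars_normal] at hy
    exact hN y (Or.inr (Finset.mem_union.1 (Finset.mem_sdiff.1 hy).1))
  have hσσ : ∀ y, (σ y).subst σ = σ y := by
    intro y
    by_cases hy : y ∈ l
    · have : y + N ∉ l := fun h => by have := hlN _ h; omega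
      simp [σ, hy, Term.subst, this]
    · simp [σ, hy, Term.subst]
  have hστ : ∀ y, y < N → (σ y).subst τ = Term.var y := by
    intro y hyN
    by_cases hy : y ∈ l
    · simp [σ, τ, hy, Term.subst]
    · simp [σ, τ, hy, Term.subst, hyN]
  have hτ : ∀ y, y < N → τ y = Term.var y := fun y hy => by simp [τ, hy]
  set bs := as.map (UAtom.subst σ) with hbs
  set B' := B.subst σ with hB'
  have hvars : ∀ z ∈ (UserC.ofList bs).vars ∪ B'.vars,
      (z < N ∧ z ∈ V) ∨ ∃ y ∈ l, z = y + N := by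
    intro z hz
    have : ∃ y ∈ (UserC.ofList as).vars ∪ B.vars, z ∈ (σ y).varFinset := by
      rcases Finset.mem_union.1 hz with hz | hz
      · obtain ⟨b, hb, hzb⟩ := UserC.mem_vars_ofList.1 hz
        obtain ⟨a, ha, rfl⟩ := List.mem_map.1 hb
        obtain ⟨y, hy, hzy⟩ := UAtom.mem_vars_subst hzb
        exact ⟨y, Finset.mem_union_left _ (UserC.mem_vars_ofList.2 ⟨a, ha, hy⟩), hzy⟩
      · obtain ⟨y, hy, hzy⟩ := Builtin.mem_vars_subst hz
        exact ⟨y, Finset.mem_union_right _ hy, hzy⟩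
    obtain ⟨y, hy, hzy⟩ := this
    by_cases hyl : y ∈ l
    · simp only [σ, hyl, if_true, Term.varFinset, Finset.mem_singleton] at hzy
      exact Or.inr ⟨y, hyl, hzy⟩
    · simp only [σ, hyl, if_false, Term.varFinset, Finset.mem_singleton] at hzy
      subst hzy
      refine Or.inl ⟨hN z (Or.inr (Finset.mem_union.1 hy)), ?_⟩
      by_contra hzV
      exact hyl (by rw [hl, State.localVars_normal]; exact Finset.mem_sdiff.2 ⟨hy, hzV⟩)
  have hl' : ∀ z ∈ (State.normal (.ofList bs) B' V).localVars, N ≤ z := by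
    intro z hz
    rw [State.localVars_normal, Finset.mem_sdiff] at hz
    rcases hvars z hz.1 with h | ⟨y, -, rfl⟩
    · exact absurd h.2 hz.2
    · omega
  have hEvars : ∀ y ∈ (UAtom.eqsList as bs).vars,
      y ∈ (UserC.ofList as).vars ∨ y ∈ (UserC.ofList bs).vars := by
    intro y hy
    refine Finset.mem_union.1 (UAtom.vars_eqsList (s := (UserC.ofList as).vars ∪
      (UserC.ofList bs).vars) (fun a ha y hy => ?_) (fun b hb y hy => ?_) hy)
    · exact Finset.mem_union_left _ (UserC.mem_vars_ofList.2 ⟨a, ha, hy⟩)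
    · exact Finset.mem_union_right _ (UserC.mem_vars_ofList.2 ⟨b, hb, hy⟩)
  refine ⟨bs, B', StateEquiv.of_matching ?_ ?_ ?_, ?_⟩
  · refine Finset.disjoint_left.2 fun y hy hy' => ?_
    have := hlN y hy
    have := hl' y hy'
    omega
  · have : Ent CT {B.toIL} ((IL.exs (State.normal (.ofList bs) B' V).localVars
        (Builtin.and (UAtom.eqsList as bs) B').toIL).subst Term.var) := by
      refine Ent.exs_intro (τ' := τ) (ent_and.2 ⟨UAtom.ent_eqsList.2 (Or.inr ?_), ?_⟩) ?_
      · rw [hbs, List.forall₂_map_right_iff, List.forall₂_same]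
        intro a ha
        rw [UAtom.subst_subst, UAtom.subst_congr (τ := fun y => (σ y).subst τ)]
        · exact .refl _
        · intro y hy
          have hyN := hN y (Or.inr (Or.inl (UserC.mem_vars_ofList.2 ⟨a, ha, hy⟩)))
          rw [hστ y hyN, hτ y hyN]
      · rw [hB', Builtin.toIL_subst, IL.subst_subst, Builtin.subst_congr (τ := Term.var),
          IL.subst_var]
        · exact Ent.hyp (by simp)
        · exact fun y hy => hστ y (hN y (Or.inr (Or.inr hy)))
      · intro y hy hy'
        refine hτ y ?_
        rw [Builtin.fv_toIL] at hy
        rw [State.localVars_normal, Finset.mem_sdiff, not_and, not_not] at hy'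
        rcases Finset.mem_union.1 hy with hy | hy
        · rcases hEvars y hy with hy | hy
          · exact hN y (Or.inr (Or.inl hy))
          · exact hN y (Or.inl (Or.inr (hy' (Finset.mem_union_left _ hy))))
        · exact hN y (Or.inl (Or.inr (hy' (Finset.mem_union_right _ hy))))
    rwa [IL.subst_var] at this
  · have : Ent CT {B'.toIL} ((IL.exs l (Builtin.and (UAtom.eqsList as bs) B).toIL).subst
        Term.var) := by
      refine Ent.exs_intro (τ' := σ) (ent_and.2 ⟨UAtom.ent_eqsList.2 (Or.inr ?_), ?_⟩) ?_
      · rw [hbs, List.forall₂_map_right_iff, List.forall₂_same]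
        intro a _
        rw [UAtom.subst_subst]
        simp only [hσσ]
        exact .refl _
      · rw [hB', Builtin.toIL_subst]
        exact Ent.hyp (by simp)
      · intro y _ hy
        simp [σ, hy]
    rwa [IL.subst_var] at this
  · refine Finset.disjoint_left.2 fun y hy hy' => ?_
    have := hN y (Or.inl (Or.inl hy))
    have := hl' y hy'
    omega

end StateLaws

/-! ### Interderivable readings come from equivalent states -/

section MainProof

variable {L : FirstOrder.Language.{u, v}} {P : ℕ → Type w} {CT : ConstraintTheory L}

theorem ent_eqsList_ofFn {Γ : Multiset (IL L ℕ)} {τ : ℕ → L.Term ℕ} {n : ℕ}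
    {f g : Fin n → UAtom L P} :
    Ent CT Γ ((UAtom.eqsList (List.ofFn f) (List.ofFn g)).toIL.subst τ) ↔
      Ent CT Γ .bot ∨ ∀ i, UAtom.Eqv CT Γ ((f i).subst τ) ((g i).subst τ) := by
  rw [UAtom.ent_eqsList, List.forall₂_iff_get]
  refine or_congr_right ⟨fun h i => ?_, fun h => ⟨by simp, fun i h₁ h₂ => ?_⟩⟩
  · simpa using h.2 i (by simp) (by simp)
  · simpa using h ⟨i, by simpa using h₁⟩

theorem exists_perm_of_perm_ofFn {α : Type*} {n : ℕ} {f : Fin n → α} {l : List α}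
    (h : l.Perm (List.ofFn f)) : ∃ π : Equiv.Perm (Fin n), l = List.ofFn (f ∘ π) := by
  classical
  obtain rfl : l.length = n := by simpa using h.length_eq
  have count : ∀ (g : Fin l.length → α) (a : α),
      Fintype.card {i // g i = a} = (List.ofFn g).count a := by
    intro g a
    have : ((Finset.univ.val.map g : Multiset α)) = List.ofFn g := by
      rw [Fin.univ_val_map]
    rw [← Multiset.coe_count, ← this, Multiset.count_map, Fintype.card_subtype, Finset.card_def,
      Finset.filter_val]
    simp only [eq_comm]
  have card : ∀ a, Fintype.card {i // l.get i = a} = Fintype.card {i // f i = a} := by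
    intro a
    rw [count, count, List.ofFn_get, h.count_eq]
  refine ⟨Equiv.ofFiberEquiv fun a => Fintype.equivOfCardEq (card a), ?_⟩
  conv_lhs => rw [← List.ofFn_get l]
  congr 1
  funext i
  exact (Equiv.ofFiberEquiv_map _ i).symm

theorem exists_eq_ofFn {α : Type*} {n : ℕ} {l : List α} (h : l.length = n) :
    ∃ f : Fin n → α, l = List.ofFn f := by
  subst h
  exact ⟨l.get, (List.ofFn_get l).symm⟩

/-- If the matching of the atoms is off by a permutation `π` in one direction, then going back and
forth repeatedly replaces `π` by each of its positive powers. -/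
theorem forces_matching_pow {n : ℕ} {f g : Fin n → UAtom L P} {B B' : Builtin L} {l l' : Finset ℕ}
    (π : Equiv.Perm (Fin n))
    (hf : ∀ y ∈ l', (∀ i, y ∉ (f i).vars) ∧ y ∉ B.vars) (hg : ∀ y ∈ l, ∀ i, y ∉ (g i).vars)
    (h : Ent CT {B.toIL}
      (IL.exs l' (Builtin.and (UAtom.eqsList (List.ofFn f) (List.ofFn g)) B').toIL))
    (h' : Ent CT {B'.toIL}
      (IL.exs l (Builtin.and (UAtom.eqsList (List.ofFn (f ∘ π)) (List.ofFn g)) B).toIL)) (k : ℕ) :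
    Ent CT {B'.toIL} (IL.exs l
      (Builtin.and (UAtom.eqsList (List.ofFn (f ∘ (π ^ (k + 1) : Equiv.Perm (Fin n))))
        (List.ofFn g)) B).toIL) := by
  induction k with
  | zero => simpa using h'
  | succ k ih =>
    refine ent_of_forces fun Γ τ hΓ => ?_
    have add : ∀ {Γ : Multiset (IL L ℕ)} {φ : IL L ℕ}, ∀ γ ∈ Γ, Ent CT (φ ::ₘ Γ) γ :=
      fun γ hγ => Ent.hyp (Multiset.mem_cons_of_mem hγ)
    refine (stable_ent _).exs_elim (h'.forces τ hΓ) fun τ₁ hτ₁ => ?_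
    set Γ₁ := (Builtin.and (UAtom.eqsList (List.ofFn (f ∘ π)) (List.ofFn g)) B).toIL.subst τ₁ ::ₘ Γ
      with hΓ₁
    obtain ⟨hE₁, hB₁⟩ := ent_and.1 (Ent.hyp (CT := CT) (Multiset.mem_cons_self _ _ : _ ∈ Γ₁))
    refine (stable_ent _).exs_elim (h.forces τ₁ hB₁) fun τ₂ hτ₂ => ?_
    set Γ₂ := (Builtin.and (UAtom.eqsList (List.ofFn f) (List.ofFn g)) B').toIL.subst τ₂ ::ₘ Γ₁
      with hΓ₂
    obtain ⟨hE₂, hB₂⟩ := ent_and.1 (Ent.hyp (CT := CT) (Multiset.mem_cons_self _ _ : _ ∈ Γ₂))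
    refine (stable_ent _).exs_elim (ih.forces τ₂ hB₂) fun τ₃ hτ₃ => ?_
    obtain ⟨hE₃, hB₃⟩ := ent_and.1 (Ent.hyp (CT := CT) (Multiset.mem_cons_self
      ((Builtin.and (UAtom.eqsList (List.ofFn (f ∘ (π ^ (k + 1) : Equiv.Perm (Fin n))))
        (List.ofFn g)) B).toIL.subst τ₃) Γ₂))
    set Γ₃ := (Builtin.and (UAtom.eqsList (List.ofFn (f ∘ (π ^ (k + 1) : Equiv.Perm (Fin n))))
        (List.ofFn g)) B).toIL.subst τ₃ ::ₘ Γ₂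
    rcases ent_eqsList_ofFn.1 hE₁ with hb | hE₁
    · exact Ent.of_bot ((hb.trans add).trans add) _
    rcases ent_eqsList_ofFn.1 hE₂ with hb | hE₂
    · exact Ent.of_bot (hb.trans add) _
    rcases ent_eqsList_ofFn.1 hE₃ with hb | hE₃
    · exact Ent.of_bot hb _
    -- the values of `l'` under `τ₃` are irrelevant for `f` and `B`
    let τ' : ℕ → L.Term ℕ := fun y => if y ∈ l then τ₃ y else τ y
    have hτ' : ∀ y ∉ l', τ' y = τ₃ y := by
      intro y hy
      by_cases hyl : y ∈ l
      · simp [τ', hyl]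
      · simp only [τ', if_neg hyl]
        rw [hτ₃ y hyl, hτ₂ y hy, hτ₁ y hyl]
    refine Ent.exs_intro (τ' := τ') (ent_and.2 ⟨ent_eqsList_ofFn.2 (Or.inr fun i => ?_), ?_⟩)
      fun y _ hy => by simp [τ', hy]
    · have e₁ : (f ((π ^ (k + 1 + 1) : Equiv.Perm (Fin n)) i)).subst τ' =
          (f ((π ^ (k + 1) : Equiv.Perm (Fin n)) (π i))).subst τ₃ := by
        rw [pow_succ, Equiv.Perm.mul_apply]
        exact UAtom.subst_congr fun y hy => hτ' y fun h => (hf y h).1 _ hy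
      have e₂ : (g (π i)).subst τ₃ = (g (π i)).subst τ₂ :=
        UAtom.subst_congr fun y hy => hτ₃ y fun h => hg y h _ hy
      have e₃ : (f (π i)).subst τ₂ = (f (π i)).subst τ₁ :=
        UAtom.subst_congr fun y hy => hτ₂ y fun h => (hf y h).1 _ hy
      have e₄ : (g i).subst τ₁ = (g i).subst τ' := by
        refine UAtom.subst_congr fun y hy => ?_
        have hyl : y ∉ l := fun h => hg y h _ hy
        simp only [τ', if_neg hyl]
        exact hτ₁ y hyl
      have s₁ := hE₃ (π i)
      have s₂ := ((hE₂ (π i)).mono add : UAtom.Eqv CT Γ₃ _ _).symm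
      have s₃ := (((hE₁ i).mono add).mono add : UAtom.Eqv CT Γ₃ _ _)
      simp only [Function.comp_apply] at s₁ s₃ ⊢
      rw [e₂] at s₁
      rw [e₃] at s₂
      rw [e₄] at s₃
      rw [e₁]
      exact s₁.trans (s₂.trans s₃)
    · rwa [Builtin.subst_congr fun y hy => hτ' y fun h => (hf y h).2 hy]

/-- Two states with the same global and disjoint local variables are equivalent if their readings
are interderivable. -/
theorem stateEquiv_of_equivMod_of_disjoint {as bs : List (UAtom L P)} {B B' : Builtin L}
    {V : Finset ℕ}
    (hd : Disjoint (State.normal (.ofList as) B V).localVars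
      (State.normal (.ofList bs) B' V).localVars)
    (h : ILL.EquivMod (sigmaCT P CT ∪ sigmaEq L P) (State.normal (.ofList as) B V).toILL
      (State.normal (.ofList bs) B' V).toILL) :
    StateEquiv CT (.normal (.ofList as) B V) (.normal (.ofList bs) B' V) := by
  have hd' := Finset.disjoint_left.1 hd
  simp only [State.localVars_normal, Finset.mem_sdiff, Finset.mem_union] at hd'
  have has : ∀ a ∈ as, ∀ y ∈ a.vars, y ∈ (UserC.ofList as).vars :=
    fun a ha y hy => UserC.mem_vars_ofList.2 ⟨a, ha, hy⟩
  have hbs : ∀ b ∈ bs, ∀ y ∈ b.vars, y ∈ (UserC.ofList bs).vars :=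
    fun b hb y hy => UserC.mem_vars_ofList.2 ⟨b, hb, hy⟩
  have hl' : ∀ y ∈ (State.normal (.ofList bs) B' V).localVars,
      (∀ a ∈ as, y ∉ a.vars) ∧ y ∉ B.vars := by
    intro y hy
    simp only [State.localVars_normal, Finset.mem_sdiff, Finset.mem_union] at hy
    exact ⟨fun a ha hya => hd' ⟨Or.inl (has a ha y hya), hy.2⟩ hy,
      fun hyB => hd' ⟨Or.inr hyB, hy.2⟩ hy⟩
  have hl : ∀ y ∈ (State.normal (.ofList as) B V).localVars, ∀ b ∈ bs, y ∉ b.vars := by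
    intro y hy b hb hyb
    simp only [State.localVars_normal, Finset.mem_sdiff, Finset.mem_union] at hy
    exact hd' hy ⟨Or.inl (hbs b hb y hyb), hy.2⟩
  -- inconsistency of one state carries over to the other
  have bot : ∀ {l : Finset ℕ} {E B B' : Builtin L}, Ent CT {B.toIL} .bot →
      Ent CT {B'.toIL} (IL.exs l (Builtin.and E B).toIL) → Ent CT {B'.toIL} .bot := by
    intro l E B B' hb hE
    refine ent_of_forces fun Γ τ hΓ => (stable_ent _).exs_elim (hE.forces τ hΓ) fun τ' _ => ?_
    exact hb.forces τ' (ent_and.1 (Ent.hyp (Multiset.mem_cons_self _ _))).2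
  rcases exists_matching_of_provable (fun a ha => Finset.disjoint_left.2 fun y hya hy =>
    (hl' y hy).1 a ha hya) h.1 with hb | ⟨as', hp, h₁⟩
  · rcases exists_matching_of_provable (fun b hb => Finset.disjoint_left.2 fun y hyb hy =>
      hl y hy b hb hyb) h.2 with hb' | ⟨bs', hp', h₂⟩
    · exact .of_inconsistent _ _ _ _ hb hb'
    · exact .of_inconsistent _ _ _ _ hb (bot hb h₂)
  · rcases exists_matching_of_provable (fun b hb => Finset.disjoint_left.2 fun y hyb hy =>
      hl y hy b hb hyb) h.2 with hb' | ⟨bs', hp', h₂⟩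
    · exact .of_inconsistent _ _ _ _ (bot hb' h₁) hb'
    · by_cases hlen : as.length = bs.length
      · have hS : StateEquiv CT (.normal (.ofList as) B V) (.normal (.ofList as') B V) :=
          .goal V ((goalEquiv_ofList_of_perm hp.symm).congr (.refl _))
        have hloc : (State.normal (.ofList as) B V).localVars =
            (State.normal (.ofList as') B V).localVars := by
          have := (goalEquiv_ofList_of_perm hp).vars_eq
          rw [UserC.vars_toGoal, UserC.vars_toGoal] at this
          rw [State.localVars_normal, State.localVars_normal, this]
        rw [hloc] at h₂ hd hl
        refine hS.trans (StateEquiv.of_matching hd h₁ ?_)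
        have hl'' : ∀ y ∈ (State.normal (.ofList bs) B' V).localVars,
            (∀ a ∈ as', y ∉ a.vars) ∧ y ∉ B.vars :=
          fun y hy => ⟨fun a ha => (hl' y hy).1 a (hp.mem_iff.1 ha), (hl' y hy).2⟩
        generalize (State.normal (.ofList as') B V).localVars = l at *
        generalize (State.normal (.ofList bs) B' V).localVars = l' at *
        obtain ⟨n, hn⟩ : ∃ n, bs.length = n := ⟨_, rfl⟩
        obtain ⟨f, rfl⟩ := exists_eq_ofFn (hp.length_eq.trans (hlen.trans hn))
        obtain ⟨g, rfl⟩ := exists_eq_ofFn hn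
        obtain ⟨ρ, rfl⟩ := exists_perm_of_perm_ofFn hp.symm
        obtain ⟨σ, rfl⟩ := exists_perm_of_perm_ofFn hp'
        -- the two matchings differ by the permutation `π`
        set π := σ⁻¹.trans ρ with hπ
        have h₂' : Ent CT {B'.toIL} (IL.exs l
            (Builtin.and (UAtom.eqsList (List.ofFn (f ∘ π)) (List.ofFn g)) B).toIL) := by
          refine ent_of_forces fun Γ τ hΓ => ?_
          refine (stable_ent _).exs_elim (h₂.forces τ hΓ) fun τ' hτ' => ?_
          obtain ⟨hE, hB⟩ := ent_and.1 (Ent.hyp (CT := CT) (Multiset.mem_cons_self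
            ((Builtin.and (UAtom.eqsList (List.ofFn (g ∘ σ)) (List.ofFn (f ∘ ρ))) B).toIL.subst
              τ') Γ))
          refine Ent.exs_intro (τ' := τ') (ent_and.2 ⟨ent_eqsList_ofFn.2 ?_, hB⟩)
            fun y _ hy => hτ' y hy
          refine (ent_eqsList_ofFn.1 hE).imp id fun h i => ?_
          have := (h (σ⁻¹ i)).symm
          simpa [hπ] using this
        have := forces_matching_pow π
          (fun y hy => ⟨fun i => (hl'' y hy).1 _ (List.mem_ofFn.2 ⟨i, rfl⟩), (hl'' y hy).2⟩)
          (fun y hy i => hl y hy _ (List.mem_ofFn.2 ⟨i, rfl⟩)) h₁ h₂' (orderOf π - 1)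
        rwa [Nat.sub_add_cancel (orderOf_pos π), pow_orderOf_eq_one] at this
      · have hb : Ent CT {B.toIL} .bot := by
          refine ent_of_forces fun Γ τ hΓ => ?_
          refine (stable_ent _).exs_elim (h₁.forces τ hΓ) fun τ' _ => ?_
          refine (UAtom.ent_eqsList.1 (ent_and.1 (Ent.hyp (Multiset.mem_cons_self _ Γ))).1).elim id
            fun h => ?_
          exact absurd (hp.length_eq.symm.trans h.length_eq) hlen
        exact .of_inconsistent _ _ _ _ hb (bot hb h₂)

theorem StateEquiv.of_equivMod {S T : State L P}
    (h : ILL.EquivMod (sigmaCT P CT ∪ sigmaEq L P) S.toILL T.toILL) : StateEquiv CT S T := by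
  obtain ⟨as₀, B₀, hS₀⟩ := S.goal.exists_normal
  obtain ⟨bs₀, B₀', hT₀⟩ := T.goal.exists_normal
  obtain ⟨VS, hVS⟩ : ∃ V, V = S.globals := ⟨_, rfl⟩
  obtain ⟨VT, hVT⟩ : ∃ V, V = T.globals := ⟨_, rfl⟩
  obtain ⟨bs, B', hT₁, hdT⟩ := StateEquiv.exists_rename CT bs₀ B₀' VT VS
  obtain ⟨as, B, hS₁, hdS⟩ := StateEquiv.exists_rename CT as₀ B₀ VS
    ((UserC.ofList bs).vars ∪ B'.vars)
  rw [State.localVars_normal, Finset.disjoint_left] at hdT hdS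
  simp only [Finset.mem_sdiff, Finset.mem_union] at hdT hdS
  have hS : StateEquiv CT S (.normal (.ofList as) B VS) := by
    subst hVS
    exact (StateEquiv.goal _ hS₀).trans hS₁
  have hT : StateEquiv CT T (.normal (.ofList bs) B' VT) := by
    subst hVT
    exact (StateEquiv.goal _ hT₀).trans hT₁
  -- common global variables: those that occur in one of the states and are global in it
  let V := (((UserC.ofList as).vars ∪ B.vars) ∩ VS) ∪ (((UserC.ofList bs).vars ∪ B'.vars) ∩ VT)
  have hmV : ∀ x, x ∈ V ↔ ((x ∈ (UserC.ofList as).vars ∨ x ∈ B.vars) ∧ x ∈ VS) ∨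
      ((x ∈ (UserC.ofList bs).vars ∨ x ∈ B'.vars) ∧ x ∈ VT) := by
    simp [V]
  have hS' : StateEquiv CT S (.normal (.ofList as) B V) := by
    refine hS.trans (StateEquiv.globals_congr fun x hx => ?_)
    simp only [Goal.vars, UserC.vars_toGoal, Builtin.vars_toGoal, Finset.mem_union] at hx
    rw [hmV]
    have := @hdS x
    grind
  have hT' : StateEquiv CT T (.normal (.ofList bs) B' V) := by
    refine hT.trans (StateEquiv.globals_congr fun x hx => ?_)
    simp only [Goal.vars, UserC.vars_toGoal, Builtin.vars_toGoal, Finset.mem_union] at hx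
    rw [hmV]
    have := @hdT x
    grind
  refine hS'.trans (StateEquiv.trans (stateEquiv_of_equivMod_of_disjoint ?_
    (hS'.equivMod.symm.trans (h.trans hT'.equivMod))) hT'.symm)
  rw [State.localVars_normal, State.localVars_normal, Finset.disjoint_left]
  simp only [Finset.mem_sdiff, Finset.mem_union]
  rintro x ⟨hx, hxV⟩ ⟨hx', -⟩
  rw [hmV] at hxV
  have := @hdS x
  grind

end MainProof

end CHR

/-- For every constraint theory `CT` and all CHR states `S`, `T`: `S ≡ T` if and only if the
linear-logic readings of `S` and `T` are interderivable modulo `Σ_CT ∪ Σ_≐`. -/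
theorem mainTheorem3 {L : FirstOrder.Language.{u, v}} {P : ℕ → Type w}
    (CT : CHR.ConstraintTheory L) (S T : CHR.State L P) :
    CHR.StateEquiv CT S T ↔
      CHR.ILL.EquivMod (CHR.sigmaCT P CT ∪ CHR.sigmaEq L P) S.toILL T.toILL :=
  ⟨fun h => h.equivMod, fun h => .of_equivMod h⟩
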